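/- **Setting.** Let $g\ge 2$ be an integer. A function $f:\mathbb N_0\to\mathbb Z$ is *$g$-additive* if $f(\sum_{i=0}^m w_ig^i)=\sum_{i=0}^m f(w_ig^i)$ for all $m\ge 0$ and $w_0,\dots,w_m\in\{0,\dots,g-1\}$. Let $\mathbf a=(a_1,\dots,a_r)$ be positive integers, $\mathbb Z_{\mathbf a}=\prod_j\mathbb Z/a_j\mathbb Z$, and let $\mathbf f=(f_1,\dots,f_r)$ be $g$-additive functions; $\mathbf f(n)\equiv\mathbf b\pmod{\mathbf a}$ means $f_j(n)\equiv b_j\pmod{a_j}$ for all $j$. A pair $(p,\ell)$ with $p\ge1$, $\ell\ge0$ is an *eventual period* of $\mathbf f$ with respect to $\mathbf a$ if $\mathbf f(dg^{i+np})\equiv\mathbf f(dg^i)\pmod{\mathbf a}$ for all $0\le d<g$, $n\ge1$, $i\ge\ell$. Let $\Sigma\subseteq\{0,\dots,g-1\}^{\mathbb N_0}$ be a subshift (closed and shift-invariant), and let $\mathcal L$ be its language, i.e. the set of all finite prefixes (including the empty word) of points of $\Sigma$. For a word $w=w_0\cdots w_{n-1}$ put $(w)_g=\sum_i w_ig^i$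 and $|w|=n$. $\Sigma$ is *mixing* if for all $u,v\in\mathcal L$ there is $n$ such that for every $m\ge n$ some $w\in\mathcal L$ with $|w|=m$ satisfies $uwv\in\mathcal L$; it is *sofic* if it is the set of label sequences of infinite paths in a labelled directed multigraph with finitely many nodes. The *follower set* of $w$ is $F(w)=\{v\in\mathcal L: wv\in\mathcal L\}$, and $w\in\mathcal L$ is *synchronizing* if $u,v\in\mathcal L$, $uw\in\mathcal L$ and $wv\in\mathcal L$ imply $uwv\in\mathcal L$. The *Fischer cover* has node set $\mathcal V=\{F(w): w \text{ synchronizing}\}$ (finite for sofic $\Sigma$) and an edge labelled $d$ from $F$ to $F'$ exactly when $F=F(w)$ and $F'=F(wd)$ for some $w$ with $wd\in\mathcal L$; write $F\overset{w}{\to}F'$ if some path from $F$ to $F'$ has label $w$. $\Sigma$ is *$k$-regular* if every node of the Fischer cover has exactly $k$ outgoing and $k$ incoming edges, and *regular* if it is $k$-regular for some $k\ge2$. For $k$-regular sofic $\Sigma$, let $\mathcal S=\mathbb Z_{\mathbf a}\times\mathcal V$ and $$M_i\big((\mathbf b,F),(\mathbf b',F')\big)=k^{-p}\,\big|\{w\in\mathcal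 L: |w|=p,\ \mathbf f(g^i(w)_g)\equiv\mathbf b'-\mathbf b\ (\mathrm{mod}\ \mathbf a),\ F\overset{w}{\to}F'\}\big| .$$ The *Markov condition* (for $(p,\ell)$) says that for every $i\ge\ell$ the matrix $M_i$ is irreducible (for all $s,s'$ there is $n\ge1$ with $M_i^n(s,s')>0$) and aperiodic ($\gcd\{n\ge1:M_i^n(s,s)>0\}=1$ for all $s$). Finally let $$A_{\Sigma,\ell}=\{(w)_g: w\in\mathcal L,\ |w|\ge\ell,\ F(w_0\cdots w_{\ell-1})\in\mathcal V\}.$$ **Proposition.** (1) Let $\Sigma$ be mixing, sofic and regular, and let $(p,\ell)$ be an eventual period of $\mathbf f$ with respect to $\mathbf a$ such that $\ell$ is at least the length of some synchronizing word. If the Markov condition holds, then there is $\gamma>0$ such that for every $\mathbf b\in\mathbb Z_{\mathbf a}$, as $N\to\infty$, $$\frac{|\{n\in A_{\Sigma,\ell}:\mathbf f(n)\equiv\mathbf b\ (\mathrm{mod}\ \mathbf a)\}\cap[0,N)|}{|A_{\Sigma,\ell}\cap[0,N)|}=\frac1{a_1\cdots a_r}+O(N^{-\gamma}).$$ (2)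 (Missing digits.) Let $D=\{d_1<\dots<d_t\}\subseteq\{0,\dots,g-1\}$ be non-empty, let $\mathcal C_{g,D}$ be the set of integers $\sum_{i=0}^m w_ig^i$ with $m\ge0$ and all $w_i\in D$, let $S_g(n)$ be the sum of the base-$g$ digits of $n$, and let $a,a'\ge1$ satisfy $\gcd(g,a)=\gcd(a,a')=1$. Put $\delta=\gcd(aa',d_2-d_1,\dots,d_t-d_1)$, $\delta_a=\gcd(\delta,a)$, $\delta_{a'}=\gcd(\delta,a')$, and suppose $\delta_a\mid d_1$ and $\delta_{a'}\mid d_1$ (in particular this always holds if $\delta=1$). Then there is $\gamma>0$ such that for every $(b,b')\in\langle\delta_a\rangle\times\langle\delta_{a'}\rangle\subseteq\mathbb Z/a\mathbb Z\times\mathbb Z/a'\mathbb Z$, as $N\to\infty$, $$\frac{|\{n\in\mathcal C_{g,D}: n\equiv b\ (\mathrm{mod}\ a),\ S_g(n)\equiv b'\ (\mathrm{mod}\ a')\}\cap[0,N)|}{|\mathcal C_{g,D}\cap[0,N)|}=\frac{\delta}{aa'}+O(N^{-\gamma}),$$ while for $(b,b')\notin\langle\delta_a\rangle\times\langle\delta_{a'}\rangle$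 no $n\in\mathcal C_{g,D}$ satisfies $n\equiv b\pmod a$ and $S_g(n)\equiv b'\pmod{a'}$. -/

import Mathlib

open Filter Asymptotics

namespace DigitShift

/-! ### Labelled directed multigraphs -/

/-- A labelled directed multigraph with nodes `V`, edges `E` and labels in `A`. -/
structure LabeledGraph (V E A : Type*) where
  source : E → V
  target : E → V
  label : E → A

namespace LabeledGraph

variable {V E A : Type*} (G : LabeledGraph V E A)

/-- `e` is an infinite path. -/
def IsInfinitePath (e : ℕ → E) : Prop := ∀ j, G.source (e (j + 1)) = G.target (e j)

/-- The set of all label sequences of infinite paths. -/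
def labelSequences : Set (ℕ → A) :=
  {x | ∃ e : ℕ → E, G.IsInfinitePath e ∧ x = fun j => G.label (e j)}

/-- `G.Reads u w v`: some finite path from `u` to `v` has label `w`. -/
inductive Reads : V → List A → V → Prop
  | nil (u : V) : Reads u [] u
  | cons (e : E) {w : List A} {v : V} (h : Reads (G.target e) w v) :
      Reads (G.source e) (G.label e :: w) v

/-- Every node has exactly `k` outgoing and exactly `k` incoming edges. -/
def IsRegular (k : ℕ) : Prop :=
  ∀ v : V, Nat.card {e : E // G.source e = v} = k ∧ Nat.card {e : E // G.target e = v} = k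

end LabeledGraph

/-! ### One-sided subshifts on the digits `0, …, g - 1` -/

/-- Closed subsets of `{0, …, g - 1}^ℕ` that are invariant under the shift. -/
abbrev Shift (g : ℕ) := SymbolicDynamics.FullShift.Subshift (Fin g) ℕ

variable {g : ℕ}

/-- All finite words (the empty one included) that are prefixes of points of `S`. -/
def language (S : Shift g) : Set (List (Fin g)) :=
  {w | ∃ x ∈ S.carrier, ∃ n : ℕ, w = (List.range n).map x}

/-- Mixing: for all words `u`, `v` of the language there is `n` such that for every `m ≥ n` some
word `w` of length `m` in the language makes `u w v` a word of the language. -/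
def IsMixing (S : Shift g) : Prop :=
  ∀ u ∈ language S, ∀ v ∈ language S, ∃ n : ℕ, ∀ m ≥ n, ∃ w ∈ language S,
    w.length = m ∧ u ++ w ++ v ∈ language S

/-- Sofic: presented by a labelled directed multigraph with finitely many nodes. -/
def IsSofic (S : Shift g) : Prop :=
  ∃ (V E : Type) (G : LabeledGraph V E (Fin g)), Finite V ∧ S.carrier = G.labelSequences

/-- The follower set of a word. -/
def follower (S : Shift g) (w : List (Fin g)) : Set (List (Fin g)) :=
  {v | v ∈ language S ∧ w ++ v ∈ language S}

/-- Synchronizing words. -/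
def IsSynchronizing (S : Shift g) (w : List (Fin g)) : Prop :=
  w ∈ language S ∧ ∀ u ∈ language S, ∀ v ∈ language S,
    u ++ w ∈ language S → w ++ v ∈ language S → u ++ w ++ v ∈ language S

/-- The nodes of the Fischer cover: the follower sets of the synchronizing words. -/
def fischerNodes (S : Shift g) : Set (Set (List (Fin g))) :=
  {F | ∃ w, IsSynchronizing S w ∧ follower S w = F}

/-- The edges of the Fischer cover: triples `(F, d, F')` of a node, a digit and a node with
`F = F(w)` and `F' = F(wd)` for some `w` such that `wd` is in the language. -/
def fischerEdges (S : Shift g) : Set (fischerNodes S × Fin g × fischerNodes S) :=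
  {e | ∃ w ∈ language S, w ++ [e.2.1] ∈ language S ∧
    (e.1 : Set (List (Fin g))) = follower S w ∧
    (e.2.2 : Set (List (Fin g))) = follower S (w ++ [e.2.1])}

/-- The Fischer cover. -/
def fischerCover (S : Shift g) : LabeledGraph (fischerNodes S) (fischerEdges S) (Fin g) where
  source e := e.1.1
  label e := e.1.2.1
  target e := e.1.2.2

/-! ### Finiteness of the set of nodes of the Fischer cover -/

theorem LabeledGraph.reads_prefix {V E A : Type*} (G : LabeledGraph V E A) (n : ℕ) :
    ∀ e : ℕ → E, G.IsInfinitePath e →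
      G.Reads (G.source (e 0)) ((List.range n).map fun j => G.label (e j)) (G.source (e n)) := by
  induction n with
  | zero => intro e _; exact .nil _
  | succ n ih =>
    intro e he
    have h := ih (fun j => e (j + 1)) (fun j => he (j + 1))
    rw [List.range_succ_eq_map]
    simp only [List.map_cons, List.map_map]
    refine LabeledGraph.Reads.cons (e 0) ?_
    rw [← he 0]
    exact h

theorem LabeledGraph.Reads.extend {V E A : Type*} {G : LabeledGraph V E A} {u q : V} {w : List A}
    (h : G.Reads u w q) :
    ∀ e : ℕ → E, G.IsInfinitePath e → G.source (e 0) = q →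
      ∃ e' : ℕ → E, G.IsInfinitePath e' ∧ G.source (e' 0) = u ∧ ∀ n : ℕ,
        ((List.range (w.length + n)).map fun j => G.label (e' j)) =
          w ++ (List.range n).map fun j => G.label (e j) := by
  induction h with
  | nil u => intro e he h0; exact ⟨e, he, h0, fun n => by simp⟩
  | cons d h ih =>
    intro e he h0
    obtain ⟨e', he', h0', hw⟩ := ih e he h0
    refine ⟨fun j => Nat.casesOn j d e', ?_, rfl, fun n => ?_⟩
    · rintro (_ | j)
      · exact h0'
      · exact he' j
    · rw [List.length_cons, Nat.add_right_comm, List.range_succ_eq_map, List.map_cons,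
        List.map_map, List.cons_append, ← hw n]
      rfl

theorem finite_fischerNodes {S : Shift g} (hS : IsSofic S) : Finite (fischerNodes S) := by
  obtain ⟨V, E, G, hV, hG⟩ := hS
  let T : List (Fin g) → Set V := fun w => {q | ∃ u, G.Reads u w q}
  let R : V → Set (List (Fin g)) := fun q => {v | ∃ e : ℕ → E, G.IsInfinitePath e ∧
    G.source (e 0) = q ∧ ∃ n : ℕ, v = (List.range n).map fun j => G.label (e j)}
  have key : ∀ w, follower S w = ⋃ q ∈ T w, R q := by
    intro w
    ext v
    simp only [Set.mem_iUnion, exists_prop]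
    constructor
    · rintro ⟨-, x, hx, n, hwv⟩
      rw [hG] at hx
      obtain ⟨e, he, rfl⟩ := hx
      have hlen : w.length + v.length = n := by
        have := congrArg List.length hwv
        simpa using this
      rw [← hlen, List.range_add, List.map_append] at hwv
      obtain ⟨h1, h2⟩ := List.append_inj hwv (by simp)
      refine ⟨G.source (e w.length), ⟨G.source (e 0), ?_⟩, fun j => e (w.length + j),
        fun j => he (w.length + j), rfl, v.length, ?_⟩
      · have := G.reads_prefix w.length e he
        rwa [← h1] at this
      · rw [List.map_map] at h2
        exact h2
    · rintro ⟨q, ⟨u, hu⟩, e, he, h0, n, rfl⟩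
      obtain ⟨e', he', -, hw⟩ := hu.extend e he h0
      refine ⟨⟨fun j => G.label (e j), ?_, n, rfl⟩, fun j => G.label (e' j), ?_, _, (hw n).symm⟩
      · rw [hG]; exact ⟨e, he, rfl⟩
      · rw [hG]; exact ⟨e', he', rfl⟩
  have hfin : (Set.range fun Q : Set V => ⋃ q ∈ Q, R q).Finite := Set.finite_range _
  refine (hfin.subset ?_).to_subtype
  rintro F ⟨w, -, rfl⟩
  exact ⟨T w, (key w).symm⟩

/-! ### Integers, digits, and additive functions -/

/-- The integer `(w)_g = w₀ + w₁ g + ⋯ + w_{n-1} g^{n-1}` of a word. -/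
def val (w : List (Fin g)) : ℕ := Nat.ofDigits g (w.map fun d => (d : ℕ))

/-- `f : ℕ → ℤ` is `g`-additive. -/
def IsGAdditive (g : ℕ) (f : ℕ → ℤ) : Prop :=
  ∀ (m : ℕ) (w : ℕ → ℕ), (∀ i, w i < g) →
    f (∑ i ∈ Finset.range (m + 1), w i * g ^ i) = ∑ i ∈ Finset.range (m + 1), f (w i * g ^ i)

/-- `f(n) ≡ b (mod a)`, coordinate by coordinate. -/
def Congr {r : ℕ} (a : Fin r → ℕ) (f : Fin r → ℕ → ℤ) (n : ℕ) (b : ∀ j, ZMod (a j)) : Prop :=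
  ∀ j, ((f j n : ℤ) : ZMod (a j)) = b j

/-- `(p, ℓ)` is an eventual period of `f` with respect to `a`, in base `g`. -/
def IsEventualPeriod (g : ℕ) {r : ℕ} (a : Fin r → ℕ) (f : Fin r → ℕ → ℤ) (p ℓ : ℕ) : Prop :=
  1 ≤ p ∧ ∀ d < g, ∀ n ≥ 1, ∀ i ≥ ℓ, ∀ j, f j (d * g ^ (i + n * p)) ≡ f j (d * g ^ i) [ZMOD (a j)]

/-- `|A ∩ [0, N)|`. -/
noncomputable def count (A : Set ℕ) (N : ℕ) : ℕ := (A ∩ Set.Ico 0 N).ncard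

/-! ### The transition matrices and the Markov condition -/

/-- The states: pairs of a residue class modulo `a` and a node of the Fischer cover. -/
abbrev State (S : Shift g) {r : ℕ} (a : Fin r → ℕ) : Type :=
  (∀ j, ZMod (a j)) × fischerNodes S

/-- The words of length `p` that lead from `F` to `F'` in the Fischer cover and satisfy
`f(g^i (w)_g) ≡ b (mod a)`. -/
def transitionWords (S : Shift g) {r : ℕ} (a : Fin r → ℕ) (f : Fin r → ℕ → ℤ) (p i : ℕ)
    (b : ∀ j, ZMod (a j)) (F F' : fischerNodes S) : Set (List (Fin g)) :=
  {w | w ∈ language S ∧ w.length = p ∧ Congr a f (g ^ i * val w) b ∧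
    (fischerCover S).Reads F w F'}

/-- The matrix `M_i`. -/
noncomputable def transitionMatrix (S : Shift g) {r : ℕ} (a : Fin r → ℕ) (f : Fin r → ℕ → ℤ)
    (k p i : ℕ) : Matrix (State S a) (State S a) ℝ :=
  fun s s' => ((k : ℝ) ^ p)⁻¹ * (transitionWords S a f p i (s'.1 - s.1) s.2 s'.2).ncard

/-- Every state has period `gcd {n ≥ 1 : Mⁿ(s, s) > 0} = 1`. -/
def IsAperiodicMatrix {ι : Type*} [Fintype ι] [DecidableEq ι] (M : Matrix ι ι ℝ) : Prop :=
  ∀ s, Nat.setGcd {n : ℕ | 1 ≤ n ∧ 0 < (M ^ n) s s} = 1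

open Classical in
/-- The Markov condition: `M_i` is irreducible and aperiodic for every `i ≥ ℓ`. Soficity enters
only to know that the set of states is finite, so that matrix powers make sense. -/
def MarkovCondition (S : Shift g) (hS : IsSofic S) {r : ℕ} (a : Fin r → ℕ) [∀ j, NeZero (a j)]
    (f : Fin r → ℕ → ℤ) (k p ℓ : ℕ) : Prop :=
  haveI : Finite (fischerNodes S) := finite_fischerNodes hS
  letI : Fintype (State S a) := Fintype.ofFinite _
  ∀ i ≥ ℓ, (transitionMatrix S a f k p i).IsIrreducible ∧
    IsAperiodicMatrix (transitionMatrix S a f k p i)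

/-- The `ℓ`-restricted language: words of length at least `ℓ` whose prefix of length `ℓ` has its
follower set among the nodes of the Fischer cover. -/
def restrictedLanguage (S : Shift g) (ℓ : ℕ) : Set (List (Fin g)) :=
  {w | w ∈ language S ∧ ℓ ≤ w.length ∧ follower S (w.take ℓ) ∈ fischerNodes S}

/-- The integers represented by words of the `ℓ`-restricted language. -/
def restrictedIntegers (S : Shift g) (ℓ : ℕ) : Set ℕ := val '' restrictedLanguage S ℓ

/-! ### Missing digits sets -/

/-- The integers that can be written in base `g` with at least one digit, all digits being
in `D`. -/
def missingDigits (g : ℕ) (D : Finset ℕ) : Set ℕ :=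
  {n | ∃ w : List ℕ, w ≠ [] ∧ (∀ d ∈ w, d ∈ D) ∧ n = Nat.ofDigits g w}

/-- The sum of the digits of `n` in base `g`. -/
def digitSum (g n : ℕ) : ℕ := (Nat.digits g n).sum

/-- The greatest common divisor of `m` and the differences `d - min D`, `d ∈ D`. -/
def digitGcd (D : Finset ℕ) (hD : D.Nonempty) (m : ℕ) : ℕ :=
  Nat.gcd m (D.gcd fun d => d - D.min' hD)

end DigitShift

open Filter Asymptotics

namespace DigitShift

variable {g : ℕ}

/-! Cut an integer after its `m` lowest digits: `n = val x + g ^ m * u` with `x` a word of length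
`m`. For fixed `u > 0`, membership of `n` in the set and its residues depend on `x` only through a
finite state. For a shift the state is the residue of `f (val x)` together with the follower set of
`x`; for missing digits it is the pair of residues of the value and of the digit sum, which lives in
the subgroup `H = ⟨δ₁⟩ × ⟨δ₂⟩`. Words that violate the prefix or digit condition have no state and
contribute nothing. Among the possible residues exactly one leads to the prescribed class, so the
deviation from the expected density over the block `[u g^m, (u+1) g^m)` is a combination of the
state counts at length `m` with coefficients of sum zero. It is small as soon as the state counts
are nearly equal.

Divided by `k ^ m`, the state counts evolve by averaging. The transition matrices have column sums
one because each node of the Fischer cover has `k` incoming edges. The eventual period leaves at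
most `p` matrices, and irreducibility with aperiodicity makes a common power of them positive.
Averaging with positive weights contracts the oscillation geometrically
(`exists_geometric_bound_of_average`). For missing digits `k = |D|`, and positivity holds because
the digit differences generate `H` and `g` is a unit modulo `a`.

An initial segment `[0, N)` consists of boundedly many `g`-adic blocks per scale, so its total
deviation is `O(μ ^ m)` with `μ < k` and `m` about `log_g N` (`exists_bound_sum_range_of_blocks`).
The set has at least `c * k ^ m` elements there, and the quotient is a negative power of `N`. Both
statements are instances of `exists_isBigO_of_recurrence`. -/

/-! ### Averaging with column stochastic matrices -/

/-- An average with weights bounded below by `ε` shrinks an interval by the factor `1 - ε`. -/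
theorem exists_interval_of_average {X : Type*} [Fintype X] [Nonempty X] {ε : ℝ} (hε : 0 ≤ ε)
    {P : X → X → ℝ} (hP : ∀ s s', ε ≤ P s s') (hcol : ∀ s', ∑ s, P s s' = 1) {v : X → ℝ}
    {lo R : ℝ} (hR : 0 ≤ R) (hv : ∀ s, lo ≤ v s ∧ v s ≤ lo + R) :
    ∃ lo', ∀ s', lo' ≤ ∑ s, v s * P s s' ∧ ∑ s, v s * P s s' ≤ lo' + (1 - ε) * R := by
  have hc : (1 : ℝ) ≤ Fintype.card X := by exact_mod_cast Fintype.card_pos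
  -- The part `ε` of every weight contributes the same amount to each average. The remaining weights
  -- are nonnegative of total `1 - |X| ε ≤ 1 - ε`, and only they produce oscillation.
  refine ⟨lo + ε * ∑ s, (v s - lo), fun s' => ?_⟩
  have key : ∑ s, v s * P s s' = lo + ε * ∑ s, (v s - lo) + ∑ s, (v s - lo) * (P s s' - ε) := by
    have h1 : ∀ s, v s * P s s' = lo * P s s' + ε * (v s - lo) + (v s - lo) * (P s s' - ε) :=
      fun s => by ring
    simp_rw [h1, Finset.sum_add_distrib, ← Finset.mul_sum, hcol]
    ring
  have h0 : 0 ≤ ∑ s, (v s - lo) * (P s s' - ε) :=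
    Finset.sum_nonneg fun s _ => mul_nonneg (by linarith [hv s]) (by linarith [hP s s'])
  have h2 : ∑ s, (v s - lo) * (P s s' - ε) ≤ ∑ s, R * (P s s' - ε) :=
    Finset.sum_le_sum fun s _ =>
      mul_le_mul_of_nonneg_right (by linarith [hv s]) (by linarith [hP s s'])
  rw [← Finset.mul_sum, Finset.sum_sub_distrib, hcol, Finset.sum_const, Finset.card_univ,
    nsmul_eq_mul] at h2
  have h3 : R * (1 - Fintype.card X * ε) ≤ (1 - ε) * R := by nlinarith [mul_nonneg hR hε]
  constructor <;> linarith

/-- A sequence of vectors obtained by repeated averaging with weights bounded below becomes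
constant at a geometric rate. -/
theorem exists_geometric_bound_of_average {X : Type*} [Fintype X] [Nonempty X]
    (v : ℕ → X → ℝ) {ℓ L : ℕ} (hL : 0 < L) {ε : ℝ} (hε : 0 < ε) (P : ℕ → X → X → ℝ)
    (hP : ∀ m ≥ ℓ, ∀ s s', ε ≤ P m s s') (hcol : ∀ m ≥ ℓ, ∀ s', ∑ s, P m s s' = 1)
    (hv : ∀ m ≥ ℓ, ∀ s', v (m + L) s' = ∑ s, v m s * P m s s') :
    ∃ C θ : ℝ, 0 ≤ C ∧ 0 < θ ∧ θ < 1 ∧ ∀ m ≥ ℓ, ∀ s s', |v m s - v m s'| ≤ C * θ ^ m := by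
  have hε1 : ε ≤ 1 := by
    obtain ⟨s⟩ := ‹Nonempty X›
    rw [← hcol ℓ le_rfl s]
    exact (hP ℓ le_rfl s s).trans (Finset.single_le_sum (f := fun t => P ℓ t s)
      (fun t _ => hε.le.trans (hP ℓ le_rfl t s)) (Finset.mem_univ s))
  -- With `1 - ε` the ratio could vanish, since `ε = 1` is possible for a single state; halving `ε`
  -- keeps it positive. Its `L`-th root is taken below because one averaging step advances the index
  -- by `L`.
  set θ₀ : ℝ := 1 - ε / 2 with hθ₀
  have hθ₀0 : 0 < θ₀ := by linarith
  have hθ₀1 : θ₀ < 1 := by linarith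
  set θ : ℝ := θ₀ ^ ((L : ℝ)⁻¹) with hθ
  have hθ0 : 0 < θ := Real.rpow_pos_of_pos hθ₀0 _
  have hθ1 : θ < 1 := Real.rpow_lt_one hθ₀0.le hθ₀1 (by positivity)
  have hθL : θ ^ L = θ₀ := Real.rpow_inv_natCast_pow hθ₀0.le hL.ne'
  -- `R` bounds all entries before the recurrence takes over; dividing by `θ ^ (ℓ + L)` in `C` makes
  -- the geometric bound valid on these initial indices.
  set R : ℝ := ∑ m ∈ Finset.range (ℓ + L), ∑ s, |v m s| with hR
  have hR0 : 0 ≤ R := Finset.sum_nonneg fun _ _ => Finset.sum_nonneg fun _ _ => abs_nonneg _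
  set C : ℝ := 2 * R / θ ^ (ℓ + L) with hC
  have hC0 : 0 ≤ C := by positivity
  refine ⟨C, θ, hC0, hθ0, hθ1, ?_⟩
  have main : ∀ m, ℓ ≤ m → ∃ lo, ∀ s, lo ≤ v m s ∧ v m s ≤ lo + C * θ ^ m := by
    intro m
    induction m using Nat.strong_induction_on with
    | _ m ih =>
      intro hm
      by_cases hlt : m < ℓ + L
      · refine ⟨-R, fun s => ?_⟩
        have h1 : |v m s| ≤ R := by
          refine (Finset.single_le_sum (f := fun s => |v m s|) (fun _ _ => abs_nonneg _)
            (Finset.mem_univ s)).trans ?_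
          exact Finset.single_le_sum (f := fun m => ∑ s, |v m s|)
            (fun _ _ => Finset.sum_nonneg fun _ _ => abs_nonneg _) (Finset.mem_range.2 hlt)
        have h2 : 2 * R ≤ C * θ ^ m := by
          rw [hC, div_mul_eq_mul_div, le_div_iff₀ (by positivity)]
          exact mul_le_mul_of_nonneg_left (pow_le_pow_of_le_one hθ0.le hθ1.le hlt.le)
            (by positivity)
        have := abs_le.1 h1
        constructor <;> linarith
      · obtain ⟨n, rfl⟩ : ∃ n, m = n + L := ⟨m - L, by omega⟩
        have hn : ℓ ≤ n := by omega
        obtain ⟨lo, hlo⟩ := ih n (by omega) hn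
        obtain ⟨lo', hlo'⟩ := exists_interval_of_average hε.le (hP n hn) (hcol n hn)
          (by positivity : 0 ≤ C * θ ^ n) hlo
        refine ⟨lo', fun s => ?_⟩
        rw [hv n hn s]
        refine ⟨(hlo' s).1, (hlo' s).2.trans ?_⟩
        have h3 : 0 ≤ C * θ ^ n := by positivity
        rw [pow_add, hθL]
        nlinarith [mul_nonneg h3 hε.le]
  intro m hm s s'
  obtain ⟨lo, hlo⟩ := main m hm
  have h1 := hlo s
  have h2 := hlo s'
  rw [abs_le]
  constructor <;> linarith

/-! ### Sums over blocks of integers -/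

theorem sum_Ico_mul_eq_sum_blocks (φ : ℕ → ℝ) (u q e : ℕ) :
    ∑ n ∈ Finset.Ico (u * q) ((u + e) * q), φ n =
      ∑ i ∈ Finset.range e, ∑ n ∈ Finset.Ico ((u + i) * q) ((u + i + 1) * q), φ n := by
  induction e with
  | zero => simp
  | succ e ih =>
    rw [Finset.sum_range_succ, ← ih, Finset.sum_Ico_consecutive]
    · rw [add_assoc u e 1]
    · exact Nat.mul_le_mul_right _ (by omega)
    · exact Nat.mul_le_mul_right _ (by omega)

/-- If the sums over the `g`-adic blocks `[h g^m, (h + 1) g^m)` are `O(μ^m)` with `μ > 1`, so are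
the sums over the initial segments of length at most `g^m`. -/
theorem exists_bound_sum_range_of_blocks {g : ℕ} (hg : 2 ≤ g) (φ : ℕ → ℝ) {μ K : ℝ} (hμ : 1 < μ)
    (hK : 0 ≤ K)
    (h : ∀ m : ℕ, ∀ u > 0, |∑ n ∈ Finset.Ico (u * g ^ m) ((u + 1) * g ^ m), φ n| ≤ K * μ ^ m) :
    ∃ C : ℝ, 0 ≤ C ∧ ∀ m N : ℕ, N ≤ g ^ m → |∑ n ∈ Finset.range N, φ n| ≤ C * μ ^ m := by
  have hμ' : 0 < μ - 1 := by linarith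
  have hg0 : (0 : ℝ) ≤ g := by positivity
  -- Chosen so that `K₁ + g * K ≤ K₁ * μ`, which closes the induction over scales; `K₂` below plays
  -- the same role with `K₁` in place of `K`.
  set K₁ : ℝ := |φ 0| + K + g * K / (μ - 1) with hK₁
  have hK₁0 : 0 ≤ K₁ := by positivity
  have hKK₁ : K ≤ K₁ := by
    have : 0 ≤ g * K / (μ - 1) := by positivity
    linarith [abs_nonneg (φ 0)]
  have hgK : g * K ≤ K₁ * (μ - 1) := by
    have h1 : g * K / (μ - 1) * (μ - 1) = g * K := by field_simp
    nlinarith [mul_nonneg (add_nonneg (abs_nonneg (φ 0)) hK) hμ'.le]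
  -- The hypothesis omits the block at `u = 0`. That block is the corresponding block of the
  -- previous scale together with `g - 1` blocks having `u > 0`.
  have step1 : ∀ m : ℕ, |∑ n ∈ Finset.Ico (0 * g ^ m) ((0 + 1) * g ^ m), φ n| ≤ K₁ * μ ^ m := by
    intro m
    induction m with
    | zero =>
      have : 0 ≤ g * K / (μ - 1) := by positivity
      simp only [pow_zero, mul_one, zero_add, Nat.Ico_zero_eq_range, Finset.sum_range_one]
      linarith
    | succ m ih =>
      obtain ⟨g', rfl⟩ : ∃ g', g = g' + 1 := ⟨g - 1, by omega⟩
      have e1 : (0 + 1) * (g' + 1) ^ (m + 1) = (0 + (g' + 1)) * (g' + 1) ^ m := by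
        rw [pow_succ]; ring
      have e2 : 0 * (g' + 1) ^ (m + 1) = 0 * (g' + 1) ^ m := by simp
      rw [e1, e2, sum_Ico_mul_eq_sum_blocks, Finset.sum_range_succ']
      refine (abs_add_le _ _).trans ?_
      have h2 : |∑ i ∈ Finset.range g', ∑ n ∈ Finset.Ico ((0 + (i + 1)) * (g' + 1) ^ m)
          ((0 + (i + 1) + 1) * (g' + 1) ^ m), φ n| ≤ g' * (K * μ ^ m) := by
        refine (Finset.abs_sum_le_sum_abs _ _).trans ?_
        refine (Finset.sum_le_sum fun i _ => h m (0 + (i + 1)) (by omega)).trans ?_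
        simp
      have h3 : 0 < μ ^ m := by positivity
      rw [pow_succ]
      push_cast at hgK
      have h4 : ((g' + 1) * K) * μ ^ m ≤ K₁ * (μ - 1) * μ ^ m :=
        mul_le_mul_of_nonneg_right hgK h3.le
      have h5 : 0 ≤ K * μ ^ m := by positivity
      nlinarith
  have full : ∀ m u : ℕ,
      |∑ n ∈ Finset.Ico (u * g ^ m) ((u + 1) * g ^ m), φ n| ≤ K₁ * μ ^ m := by
    intro m u
    rcases Nat.eq_zero_or_pos u with rfl | hu
    · exact step1 m
    · exact (h m u hu).trans (mul_le_mul_of_nonneg_right hKK₁ (by positivity))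
  set K₂ : ℝ := K₁ + g * K₁ / (μ - 1) with hK₂
  have hK₂0 : 0 ≤ K₂ := by positivity
  have hK₁K₂ : K₁ ≤ K₂ := by
    have : 0 ≤ g * K₁ / (μ - 1) := by positivity
    linarith
  have hgK₁ : g * K₁ ≤ K₂ * (μ - 1) := by
    have h1 : g * K₁ / (μ - 1) * (μ - 1) = g * K₁ := by field_simp
    nlinarith [mul_nonneg hK₁0 hμ'.le]
  -- A beginning of a block is made of at most `g` full blocks of the next lower scale and one
  -- beginning of such a block.
  have partial_block : ∀ m u R : ℕ, R ≤ g ^ m →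
      |∑ n ∈ Finset.Ico (u * g ^ m) (u * g ^ m + R), φ n| ≤ K₂ * μ ^ m := by
    intro m
    induction m with
    | zero =>
      intro u R hR
      rcases Nat.eq_zero_or_pos R with rfl | hR0
      · simpa using hK₂0
      · obtain rfl : R = 1 := by simp at hR; omega
        have := full 0 u
        simp only [pow_zero, mul_one] at this ⊢
        exact this.trans hK₁K₂
    | succ m ih =>
      intro u R hR
      have hgm : 0 < g ^ m := by positivity
      have he : R / g ^ m ≤ g := by
        refine Nat.div_le_of_le_mul ?_
        rwa [← pow_succ]
      have e1 : u * g ^ (m + 1) = u * g * g ^ m := by rw [pow_succ]; ring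
      have e2 : u * g * g ^ m + R = (u * g + R / g ^ m) * g ^ m + R % g ^ m := by
        have := Nat.div_add_mod' R (g ^ m)
        rw [add_mul]; omega
      rw [e1, e2, ← Finset.sum_Ico_consecutive _
        (Nat.mul_le_mul_right _ (Nat.le_add_right (u * g) (R / g ^ m))) (Nat.le_add_right _ _),
        sum_Ico_mul_eq_sum_blocks]
      refine (abs_add_le _ _).trans ?_
      have h1 := ih (u * g + R / g ^ m) (R % g ^ m) (Nat.mod_lt _ hgm).le
      have h2 : |∑ i ∈ Finset.range (R / g ^ m), ∑ n ∈ Finset.Ico ((u * g + i) * g ^ m)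
          ((u * g + i + 1) * g ^ m), φ n| ≤ g * (K₁ * μ ^ m) := by
        refine (Finset.abs_sum_le_sum_abs _ _).trans ?_
        refine (Finset.sum_le_sum fun i _ => full m (u * g + i)).trans ?_
        rw [Finset.sum_const, Finset.card_range, nsmul_eq_mul]
        exact mul_le_mul_of_nonneg_right (by exact_mod_cast he) (by positivity)
      have h3 : 0 < μ ^ m := by positivity
      have h4 : (g * K₁) * μ ^ m ≤ K₂ * (μ - 1) * μ ^ m :=
        mul_le_mul_of_nonneg_right hgK₁ h3.le
      rw [pow_succ]
      nlinarith
  refine ⟨K₂, hK₂0, fun m N hN => ?_⟩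
  have := partial_block m 0 N hN
  simpa using this

open Classical in
theorem count_eq_sum (A : Set ℕ) (N : ℕ) :
    (count A N : ℝ) = ∑ n ∈ Finset.range N, if n ∈ A then 1 else 0 := by
  rw [Finset.sum_boole, count]
  congr 1
  rw [← Set.ncard_coe_finset]
  congr 1
  ext n
  simp [and_comm]

theorem count_mono (A : Set ℕ) {M N : ℕ} (h : M ≤ N) : count A M ≤ count A N := by
  refine Set.ncard_le_ncard (fun n hn => ⟨hn.1, Nat.zero_le _, hn.2.2.trans_le h⟩) ?_
  exact (Set.finite_Ico 0 N).subset Set.inter_subset_right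

open Classical in
/-- The deviation from density `κ` of the integers of `A` with property `B`, at one integer. -/
noncomputable def deviation (A : Set ℕ) (B : ℕ → Prop) (κ : ℝ) (n : ℕ) : ℝ :=
  if n ∈ A then (if B n then 1 else 0) - κ else 0

theorem abs_deviation_le (A : Set ℕ) (B : ℕ → Prop) (κ : ℝ) (n : ℕ) :
    |deviation A B κ n| ≤ 1 + |κ| := by
  unfold deviation
  split_ifs
  · exact (abs_sub _ _).trans (by simp)
  · simp
  · rw [abs_zero]; positivity

theorem sum_deviation (A : Set ℕ) (B : ℕ → Prop) (κ : ℝ) (N : ℕ) :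
    ∑ n ∈ Finset.range N, deviation A B κ n = count {n | n ∈ A ∧ B n} N - κ * count A N := by
  classical
  rw [count_eq_sum, count_eq_sum, Finset.mul_sum, ← Finset.sum_sub_distrib]
  refine Finset.sum_congr rfl fun n _ => ?_
  simp only [deviation, Set.mem_ofPred_eq]
  by_cases h1 : n ∈ A <;> by_cases h2 : B n <;> simp [h1, h2]

/-- A linear combination whose coefficients have sum zero is controlled by the differences. -/
theorem abs_sum_mul_le_of_sum_eq_zero {X : Type*} [Fintype X] {x c : X → ℝ} {R : ℝ}
    (hx : ∀ s s', |x s - x s'| ≤ R) (hc : ∀ s, |c s| ≤ 1) (h0 : ∑ s, c s = 0) :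
    |∑ s, x s * c s| ≤ Fintype.card X * R := by
  rcases isEmpty_or_nonempty X with _ | ⟨⟨t⟩⟩
  · simp
  have h1 : ∑ s, x s * c s = ∑ s, (x s - x t) * c s := by
    simp_rw [sub_mul, Finset.sum_sub_distrib, ← Finset.mul_sum, h0, mul_zero, sub_zero]
  rw [h1]
  refine (Finset.abs_sum_le_sum_abs _ _).trans ?_
  have h2 : ∀ s ∈ Finset.univ, |(x s - x t) * c s| ≤ R := fun s _ => by
    rw [abs_mul]
    exact (mul_le_of_le_one_right (abs_nonneg _) (hc s)).trans (hx s t)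
  refine (Finset.sum_le_sum h2).trans ?_
  simp

/-- Equidistribution from a recurrence: `x m s` counts words of length `m` by their states, and the
deviations over `g`-adic blocks are combinations of these numbers with coefficient sum zero. -/
theorem exists_isBigO_of_recurrence {X : Type*} [Fintype X] [Nonempty X] {g k : ℕ} (hg : 2 ≤ g)
    (hk : 2 ≤ k) (x : ℕ → X → ℝ) {ℓ L : ℕ} (hL : 0 < L) {ε : ℝ} (hε : 0 < ε)
    (P : ℕ → X → X → ℝ) (hP : ∀ m ≥ ℓ, ∀ s s', ε ≤ P m s s')
    (hcol : ∀ m ≥ ℓ, ∀ s', ∑ s, P m s s' = 1)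
    (hx : ∀ m ≥ ℓ, ∀ s', x (m + L) s' = (k : ℝ) ^ L * ∑ s, x m s * P m s s')
    (A : Set ℕ) {c : ℝ} (hc : 0 < c) (hlow : ∀ m ≥ ℓ, c * (k : ℝ) ^ m ≤ count A (g ^ m)) :
    ∃ γ : ℝ, 0 < γ ∧ ∀ (B : ℕ → Prop) (κ : ℝ),
      (∀ m ≥ ℓ, ∀ u > 0, ∃ z : X → ℝ, (∀ s, |z s| ≤ 1) ∧ ∑ s, z s = 0 ∧
        ∑ n ∈ Finset.Ico (u * g ^ m) ((u + 1) * g ^ m), deviation A B κ n = ∑ s, x m s * z s) →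
      (fun N : ℕ => (count {n | n ∈ A ∧ B n} N : ℝ) / count A N - κ)
        =O[atTop] fun N : ℕ => (N : ℝ) ^ (-γ) := by
  have hk0 : (0 : ℝ) < k := by positivity
  have hk2 : (2 : ℝ) ≤ k := by exact_mod_cast hk
  have hg1 : (1 : ℝ) < g := by exact_mod_cast (by omega : 1 < g)
  obtain ⟨C, θ, hC, hθ0, hθ1, hosc⟩ := exists_geometric_bound_of_average
    (fun m s => x m s / (k : ℝ) ^ m) hL hε P hP hcol (fun m hm s' => by
      rw [hx m hm, pow_add]
      simp_rw [div_mul_eq_mul_div]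
      rw [← Finset.sum_div]
      field_simp)
  -- Since `k ≥ 2`, the floor `3 / 4` guarantees `μ = k * η > 1`, as the summation over scales
  -- requires.
  set η : ℝ := max θ (3 / 4) with hη
  have hη0 : 0 < η := hθ0.trans_le (le_max_left _ _)
  have hη1 : η < 1 := max_lt hθ1 (by norm_num)
  have hη34 : 3 / 4 ≤ η := le_max_right _ _
  have hlog : 0 < Real.log g := Real.log_pos hg1
  -- Defined by `g ^ (-γ) = η`. It is fixed before `B` and `κ`, so one exponent serves all residue
  -- classes.
  set γ : ℝ := -Real.log η / Real.log g with hγ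
  have hγ0 : 0 < γ := div_pos (neg_pos.2 (Real.log_neg hη0 hη1)) hlog
  have hgγ : (g : ℝ) ^ (-γ) = η := by
    rw [Real.rpow_def_of_pos (by linarith), hγ, neg_div, neg_neg, mul_div_cancel₀ _ hlog.ne',
      Real.exp_log hη0]
  refine ⟨γ, hγ0, fun B κ hB => ?_⟩
  set μ : ℝ := k * η with hμ
  have hμ1 : 1 < μ := by nlinarith
  -- The first summand serves the scales `m ≥ ℓ`; the second is the trivial bound for a block with
  -- fewer than `g ^ ℓ` elements.
  set K : ℝ := Fintype.card X * C + (g : ℝ) ^ ℓ * (1 + |κ|) with hK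
  have hK0 : 0 ≤ K := by positivity
  have hblock : ∀ m : ℕ, ∀ u > 0,
      |∑ n ∈ Finset.Ico (u * g ^ m) ((u + 1) * g ^ m), deviation A B κ n| ≤ K * μ ^ m := by
    intro m u hu
    have hμm : 1 ≤ μ ^ m := one_le_pow₀ hμ1.le
    have hX : 0 ≤ (Fintype.card X : ℝ) * C := by positivity
    have hG : 0 ≤ (g : ℝ) ^ ℓ * (1 + |κ|) := by positivity
    rcases lt_or_ge m ℓ with hm | hm
    · refine (Finset.abs_sum_le_sum_abs _ _).trans ?_
      refine (Finset.sum_le_sum fun n _ => abs_deviation_le A B κ n).trans ?_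
      rw [Finset.sum_const, Nat.card_Ico, nsmul_eq_mul,
        show (u + 1) * g ^ m - u * g ^ m = g ^ m by rw [add_mul, one_mul]; omega]
      push_cast
      have h1 : (g : ℝ) ^ m * (1 + |κ|) ≤ (g : ℝ) ^ ℓ * (1 + |κ|) :=
        mul_le_mul_of_nonneg_right (pow_le_pow_right₀ hg1.le hm.le) (by positivity)
      nlinarith
    · obtain ⟨z, hz, hz0, hsum⟩ := hB m hm u hu
      rw [hsum]
      have hR : ∀ s s', |x m s - x m s'| ≤ C * μ ^ m := by
        intro s s'
        have h1 := hosc m hm s s'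
        rw [← sub_div, abs_div, abs_of_pos (pow_pos hk0 m), div_le_iff₀ (pow_pos hk0 m)] at h1
        refine h1.trans ?_
        rw [hμ, mul_pow, mul_assoc, mul_comm (θ ^ m)]
        gcongr
        exact le_max_left _ _
      refine (abs_sum_mul_le_of_sum_eq_zero hR hz hz0).trans ?_
      rw [← mul_assoc]
      exact mul_le_mul_of_nonneg_right (by linarith) (by linarith)
  obtain ⟨C₂, hC₂, hsum⟩ := exists_bound_sum_range_of_blocks hg _ hμ1 hK0 hblock
  refine IsBigO.of_bound (C₂ * μ / c / η) ?_
  filter_upwards [eventually_ge_atTop (g ^ ℓ)] with N hN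
  have hN0 : 0 < N := lt_of_lt_of_le (by positivity) hN
  set M : ℕ := Nat.log g N with hM
  have hMN : g ^ M ≤ N := Nat.pow_log_le_self g hN0.ne'
  have hNM : N < g ^ (M + 1) := Nat.lt_pow_succ_log_self (by omega) N
  have hℓM : ℓ ≤ M := Nat.le_log_of_pow_le (by omega) hN
  have hcount : c * (k : ℝ) ^ M ≤ count A N :=
    (hlow M hℓM).trans (by exact_mod_cast count_mono A hMN)
  have hpos : 0 < c * (k : ℝ) ^ M := by positivity
  have hA0 : (0 : ℝ) < count A N := hpos.trans_le hcount
  have hD := hsum (M + 1) N hNM.le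
  rw [sum_deviation] at hD
  have hrate : η ^ M ≤ (N : ℝ) ^ (-γ) / η := by
    rw [le_div_iff₀ hη0, ← pow_succ, ← hgγ, ← Real.rpow_natCast, ← Real.rpow_mul (by positivity),
      mul_comm, Real.rpow_mul (by positivity), Real.rpow_natCast]
    exact Real.rpow_le_rpow_of_nonpos (by exact_mod_cast hN0) (by exact_mod_cast hNM.le)
      (by linarith)
  have hE : (count {n | n ∈ A ∧ B n} N : ℝ) / count A N - κ =
      (count {n | n ∈ A ∧ B n} N - κ * count A N) / count A N := by
    field_simp
  rw [Real.norm_eq_abs, Real.norm_eq_abs, hE, abs_div, abs_of_pos hA0,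
    abs_of_nonneg (by positivity : 0 ≤ (N : ℝ) ^ (-γ))]
  calc |(count {n | n ∈ A ∧ B n} N : ℝ) - κ * count A N| / count A N
      ≤ C₂ * μ ^ (M + 1) / (c * (k : ℝ) ^ M) := by gcongr
    _ = C₂ * μ / c * η ^ M := by
      rw [pow_succ, hμ, mul_pow]
      field_simp
    _ ≤ C₂ * μ / c * ((N : ℝ) ^ (-γ) / η) := by gcongr
    _ = C₂ * μ / c / η * (N : ℝ) ^ (-γ) := by ring

/-! ### Words of a given length and the integers they represent -/

/-- The words of length `n`. -/
noncomputable def words (g n : ℕ) : Finset (List (Fin g)) :=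
  (List.finite_length_eq (Fin g) n).toFinset

@[simp]
theorem mem_words {n : ℕ} {w : List (Fin g)} : w ∈ words g n ↔ w.length = n := by
  simp [words]

theorem sum_words_add (m p : ℕ) (F : List (Fin g) → ℝ) :
    ∑ z ∈ words g (m + p), F z = ∑ x ∈ words g m, ∑ w ∈ words g p, F (x ++ w) := by
  rw [← Finset.sum_product']
  refine (Finset.sum_bij (fun q _ => q.1 ++ q.2) ?_ ?_ ?_ fun _ _ => rfl).symm
  · simp +contextual
  · rintro ⟨x, w⟩ hq ⟨x', w'⟩ hq' h
    simp only [Finset.mem_product, mem_words] at hq hq'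
    obtain ⟨rfl, rfl⟩ := List.append_inj h (hq.1.trans hq'.1.symm)
    rfl
  · intro z hz
    rw [mem_words] at hz
    refine ⟨(z.take m, z.drop m), ?_, List.take_append_drop _ _⟩
    simp [hz]

@[simp]
theorem val_nil : val ([] : List (Fin g)) = 0 := rfl

theorem val_cons (d : Fin g) (w : List (Fin g)) : val (d :: w) = d + g * val w := by
  simp [val, Nat.ofDigits_cons]

theorem val_eq_ofDigits_map (w : List (Fin g)) :
    val w = Nat.ofDigits g (w.map fun d : Fin g => (d : ℕ)) := by
  induction w with
  | nil => rfl
  | cons d w ih => rw [val_cons, ih, List.map_cons, Nat.ofDigits_cons]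

theorem val_append (x w : List (Fin g)) : val (x ++ w) = val x + g ^ x.length * val w := by
  simp [val, Nat.ofDigits_append]

theorem val_lt (w : List (Fin g)) : val w < g ^ w.length := by
  induction w with
  | nil => simp
  | cons d w ih =>
    rw [val_cons, List.length_cons, pow_succ']
    have h1 := d.isLt
    calc d + g * val w < g + g * val w := by omega
      _ = g * (val w + 1) := by ring
      _ ≤ g * g ^ w.length := Nat.mul_le_mul_left _ ih

theorem val_append_mod (x w : List (Fin g)) : val (x ++ w) % g ^ x.length = val x := by
  rw [val_append, Nat.add_mul_mod_self_left, Nat.mod_eq_of_lt (val_lt x)]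

theorem val_append_div (x w : List (Fin g)) : val (x ++ w) / g ^ x.length = val w := by
  have h := val_lt x
  rw [val_append, Nat.add_mul_div_left _ _ (by omega), Nat.div_eq_of_lt h, zero_add]

theorem eq_of_val_eq {x w : List (Fin g)} (hl : x.length = w.length) (h : val x = val w) :
    x = w := by
  induction x generalizing w with
  | nil => exact (List.length_eq_zero_iff.1 hl.symm).symm
  | cons d x ih =>
    obtain _ | ⟨e, w⟩ := w
    · simp at hl
    · have hg : 0 < g := d.pos
      rw [val_cons, val_cons] at h
      have h1 : (d : ℕ) = e := by
        have := congrArg (· % g) h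
        simpa [Nat.mod_eq_of_lt d.isLt, Nat.mod_eq_of_lt e.isLt] using this
      have h2 : val x = val w := Nat.eq_of_mul_eq_mul_left hg (by omega)
      rw [Fin.ext h1, ih (by simpa using hl) h2]

theorem exists_word_of_lt (hg : 0 < g) (m n : ℕ) (h : n < g ^ m) :
    ∃ w : List (Fin g), w.length = m ∧ val w = n := by
  induction m generalizing n with
  | zero => exact ⟨[], rfl, by simp at h; simp [h]⟩
  | succ m ih =>
    obtain ⟨w, hw, hn⟩ := ih (n / g) (Nat.div_lt_of_lt_mul (by rwa [← pow_succ']))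
    refine ⟨⟨n % g, Nat.mod_lt _ hg⟩ :: w, by simp [hw], ?_⟩
    rw [val_cons, hn]
    exact Nat.mod_add_div n g

theorem sum_block_eq_sum_words (hg : 0 < g) (φ : ℕ → ℝ) (m u : ℕ) :
    ∑ n ∈ Finset.Ico (u * g ^ m) ((u + 1) * g ^ m), φ n =
      ∑ x ∈ words g m, φ (val x + g ^ m * u) := by
  symm
  refine Finset.sum_bij (fun x _ => val x + g ^ m * u) ?_ ?_ ?_ fun _ _ => rfl
  · intro x hx
    have h := val_lt x
    rw [mem_words] at hx
    rw [hx] at h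
    rw [Finset.mem_Ico, add_mul, one_mul, mul_comm u]
    omega
  · intro x hx w hw h
    rw [mem_words] at hx hw
    exact eq_of_val_eq (hx.trans hw.symm) (by omega)
  · intro n hn
    rw [Finset.mem_Ico, add_mul, one_mul] at hn
    obtain ⟨w, hw, hv⟩ := exists_word_of_lt hg m (n - u * g ^ m) (by omega)
    exact ⟨w, mem_words.2 hw, by rw [hv, mul_comm (g ^ m)]; omega⟩

theorem exists_map_eq_of_lt {l : List ℕ} (hl : ∀ d ∈ l, d < g) :
    ∃ y : List (Fin g), y.map (fun d : Fin g => (d : ℕ)) = l := by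
  induction l with
  | nil => exact ⟨[], rfl⟩
  | cons d l ih =>
    obtain ⟨y, rfl⟩ := ih fun e he => hl e (List.mem_cons_of_mem _ he)
    exact ⟨⟨d, hl d List.mem_cons_self⟩ :: y, rfl⟩

/-- Every integer has a representation that is a prefix of all its representations. -/
theorem exists_minimal_word (hg : 2 ≤ g) (u : ℕ) :
    ∃ y : List (Fin g), val y = u ∧ ∀ w : List (Fin g), val w = u → y <+: w := by
  -- The standard expansion has no zero in its top position, so it is the shortest word for `u`; the
  -- others only append zeros at the high end.
  obtain ⟨y, hy⟩ := exists_map_eq_of_lt fun d (hd : d ∈ Nat.digits g u) =>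
    Nat.digits_lt_base (by omega) hd
  have hv : val y = u := by rw [val_eq_ofDigits_map, hy, Nat.ofDigits_digits]
  refine ⟨y, hv, fun w hw => ?_⟩
  have hlen : y.length ≤ w.length := by
    have h1 : y.length = (Nat.digits g u).length := by rw [← hy, List.length_map]
    rw [h1, Nat.digits_length_le_iff (by omega), ← hw]
    exact val_lt w
  have hu : u < g ^ y.length := by rw [← hv]; exact val_lt y
  have h2 := val_append_mod (w.take y.length) (w.drop y.length)
  rw [List.take_append_drop, List.length_take_of_le hlen, hw, Nat.mod_eq_of_lt hu, ← hv] at h2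
  rw [eq_of_val_eq (List.length_take_of_le hlen).symm h2]
  exact List.take_prefix _ _

/-- The representations of `val x + g ^ |x| * u` with `u > 0` begin with `x`. -/
theorem exists_eq_append_of_val_eq {x w : List (Fin g)} {u : ℕ} (hg : 2 ≤ g) (hu : 0 < u)
    (h : val w = val x + g ^ x.length * u) : ∃ y, w = x ++ y ∧ val y = u := by
  have hlen : x.length ≤ w.length := by
    by_contra! hlt
    have h1 := val_lt w
    have h2 : g ^ w.length ≤ g ^ x.length := Nat.pow_le_pow_right (by omega) hlt.le
    have h3 : g ^ x.length ≤ g ^ x.length * u := Nat.le_mul_of_pos_right _ hu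
    omega
  have hx := val_lt x
  have h1 := val_append_mod (w.take x.length) (w.drop x.length)
  have h2 := val_append_div (w.take x.length) (w.drop x.length)
  rw [List.take_append_drop, List.length_take_of_le hlen, h] at h1 h2
  rw [Nat.add_mul_mod_self_left, Nat.mod_eq_of_lt hx] at h1
  rw [Nat.add_mul_div_left _ _ (by omega), Nat.div_eq_of_lt hx, zero_add] at h2
  refine ⟨w.drop x.length, ?_, h2.symm⟩
  conv_lhs => rw [← List.take_append_drop x.length w]
  rw [← eq_of_val_eq (List.length_take_of_le hlen).symm h1]

/-! ### Additive functions -/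

theorem sum_digit_mul_pow (g n M : ℕ) :
    ∑ i ∈ Finset.range M, n / g ^ i % g * g ^ i = n % g ^ M := by
  induction M with
  | zero => simp [Nat.mod_one]
  | succ M ih => rw [Finset.sum_range_succ, ih, Nat.mod_pow_succ, mul_comm (g ^ M)]

namespace IsGAdditive

variable {f : ℕ → ℤ}

theorem map_zero (hf : IsGAdditive g f) (hg : 0 < g) : f 0 = 0 := by
  -- Two zero digits give `f 0 = f 0 + f 0`; a single digit would give nothing.
  have := hf 1 (fun _ => 0) (fun _ => hg)
  simp only [zero_mul, Finset.sum_const_zero, Finset.sum_const, Finset.card_range] at this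
  simp at this
  omega

theorem map_mod_pow_succ (hf : IsGAdditive g f) (hg : 0 < g) (n M : ℕ) :
    f (n % g ^ (M + 1)) = f (n % g ^ M) + f (n / g ^ M % g * g ^ M) := by
  have key : ∀ M, f (n % g ^ M) = ∑ i ∈ Finset.range M, f (n / g ^ i % g * g ^ i) := by
    rintro (_ | M)
    · simpa [Nat.mod_one] using hf.map_zero hg
    · rw [← sum_digit_mul_pow]
      exact hf M _ fun i => Nat.mod_lt _ hg
  rw [key, key, Finset.sum_range_succ]

/-- Both arguments have the same digits from position `m` on, so truncating to `m + j` digits and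
raising `j` adds equal terms to both sides. Truncation has no effect once `j` is large. -/
theorem map_add_mul (hf : IsGAdditive g f) (hg : 2 ≤ g) {a m : ℕ} (ha : a < g ^ m) (b : ℕ) :
    f (a + g ^ m * b) = f a + f (g ^ m * b) := by
  have hg0 : 0 < g := by omega
  have key : ∀ j, f ((a + g ^ m * b) % g ^ (m + j)) = f a + f (g ^ m * b % g ^ (m + j)) := by
    intro j
    induction j with
    | zero =>
      rw [add_zero, Nat.add_mul_mod_self_left, Nat.mod_eq_of_lt ha, Nat.mul_mod_right,
        hf.map_zero hg0, add_zero]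
    | succ j ih =>
      have h : (a + g ^ m * b) / g ^ (m + j) = g ^ m * b / g ^ (m + j) := by
        rw [pow_add, ← Nat.div_div_eq_div_mul, ← Nat.div_div_eq_div_mul,
          Nat.add_mul_div_left _ _ (by positivity), Nat.div_eq_of_lt ha, zero_add,
          Nat.mul_div_cancel_left _ (by positivity)]
      rw [← add_assoc, hf.map_mod_pow_succ hg0, hf.map_mod_pow_succ hg0 (g ^ m * b), ih, h,
        add_assoc]
  have hlt : a + g ^ m * b < g ^ (m + (a + g ^ m * b)) :=
    (Nat.lt_pow_self (by omega)).trans_le (Nat.pow_le_pow_right hg0 (by omega))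
  have := key (a + g ^ m * b)
  rwa [Nat.mod_eq_of_lt hlt, Nat.mod_eq_of_lt (by omega)] at this

theorem map_pow_mul_val_cons (hf : IsGAdditive g f) (hg : 2 ≤ g) (i : ℕ) (d : Fin g)
    (w : List (Fin g)) :
    f (g ^ i * val (d :: w)) = f (d * g ^ i) + f (g ^ (i + 1) * val w) := by
  have h1 : (d : ℕ) * g ^ i < g ^ (i + 1) := by
    rw [pow_succ']
    exact Nat.mul_lt_mul_of_pos_right d.isLt (by positivity)
  rw [← hf.map_add_mul hg h1, val_cons]
  congr 1
  ring

end IsGAdditive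

/-- Along an eventual period, the residues of an additive function on shifted words repeat. -/
theorem IsEventualPeriod.modEq_val {r : ℕ} {a : Fin r → ℕ} {f : Fin r → ℕ → ℤ} {p ℓ : ℕ}
    (h : IsEventualPeriod g a f p ℓ) (hg : 2 ≤ g) (hf : ∀ j, IsGAdditive g (f j)) (n : ℕ)
    (w : List (Fin g)) (i : ℕ) (hi : ℓ ≤ i) (j : Fin r) :
    f j (g ^ (i + n * p) * val w) ≡ f j (g ^ i * val w) [ZMOD a j] := by
  rcases Nat.eq_zero_or_pos n with rfl | hn
  · simp
  induction w generalizing i with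
  | nil => exact Int.ModEq.refl _
  | cons d w ih =>
    rw [(hf j).map_pow_mul_val_cons hg, (hf j).map_pow_mul_val_cons hg]
    refine (h.2 d d.isLt n hn i hi j).add ?_
    rw [add_right_comm]
    exact ih (i + 1) (by omega)

/-! ### Primitivity of irreducible aperiodic matrices -/

/-- Exponents of positive return to `s` are closed under addition and have gcd one, so they contain
all large integers. Irreducibility then supplies one fixed passage from `s` to `s'`. -/
theorem eventually_pow_pos {ι : Type*} [Fintype ι] [DecidableEq ι] {M : Matrix ι ι ℝ}
    (hM : M.IsIrreducible) (hM' : IsAperiodicMatrix M) :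
    ∀ᶠ n in atTop, ∀ s s', 0 < (M ^ n) s s' := by
  have hmul : ∀ (m n : ℕ) (s t u : ι), 0 < (M ^ m) s t → 0 < (M ^ n) t u →
      0 < (M ^ (m + n)) s u := by
    intro m n s t u h1 h2
    rw [pow_add, Matrix.mul_apply]
    exact (mul_pos h1 h2).trans_le (Finset.single_le_sum (f := fun t => (M ^ m) s t * (M ^ n) t u)
      (fun t _ => mul_nonneg (Matrix.pow_apply_nonneg hM.nonneg m s t)
        (Matrix.pow_apply_nonneg hM.nonneg n t u)) (Finset.mem_univ t))
  rw [eventually_all]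
  intro s
  rw [eventually_all]
  intro s'
  obtain ⟨k₀, -, hk₀⟩ := (Matrix.isIrreducible_iff_exists_pow_pos hM.nonneg).1 hM s s'
  obtain ⟨n₀, hn₀⟩ := Nat.exists_mem_closure_of_ge {n : ℕ | 1 ≤ n ∧ 0 < (M ^ n) s s}
  rw [hM' s] at hn₀
  have hclosure : ∀ n ∈ AddSubmonoid.closure {n : ℕ | 1 ≤ n ∧ 0 < (M ^ n) s s},
      0 < (M ^ n) s s := by
    intro n hn
    induction hn using AddSubmonoid.closure_induction with
    | mem n hn => exact hn.2
    | zero => simp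
    | add m n _ _ h1 h2 => exact hmul m n s s s h1 h2
  filter_upwards [eventually_ge_atTop (n₀ + k₀)] with n hn
  obtain ⟨m, rfl⟩ : ∃ m, n = m + k₀ := ⟨n - k₀, by omega⟩
  exact hmul m k₀ s s s' (hclosure m (hn₀ m (by omega) (one_dvd _))) hk₀

theorem sum_pow_apply_eq_one {ι : Type*} [Fintype ι] [DecidableEq ι] {M : Matrix ι ι ℝ}
    (hM : ∀ s', ∑ s, M s s' = 1) (n : ℕ) (s' : ι) : ∑ s, (M ^ n) s s' = 1 := by
  induction n generalizing s' with
  | zero => simp [Matrix.one_apply]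
  | succ n ih =>
    simp_rw [pow_succ, Matrix.mul_apply]
    rw [Finset.sum_comm]
    simp_rw [← Finset.sum_mul, ih, one_mul, hM]

/-! ### The language of a subshift and its Fischer cover -/

section Language

variable {S : Shift g}

theorem language_prefix {x y : List (Fin g)} (h : x ++ y ∈ language S) : x ∈ language S := by
  obtain ⟨z, hz, n, hn⟩ := h
  refine ⟨z, hz, x.length, ?_⟩
  have hlen : x.length + y.length = n := by simpa using congrArg List.length hn
  rw [← hlen, List.range_add, List.map_append] at hn
  exact (List.append_inj hn (by simp)).1

theorem language_suffix {x y : List (Fin g)} (h : x ++ y ∈ language S) : y ∈ language S := by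
  obtain ⟨z, hz, n, hn⟩ := h
  refine ⟨_, S.mapsTo x.length hz, y.length, ?_⟩
  have hlen : x.length + y.length = n := by simpa using congrArg List.length hn
  rw [← hlen, List.range_add, List.map_append] at hn
  have h2 := (List.append_inj hn (by simp)).2
  rwa [List.map_map] at h2

theorem exists_append_mem_language {w : List (Fin g)} (h : w ∈ language S) (n : ℕ) :
    ∃ v : List (Fin g), v.length = n ∧ w ++ v ∈ language S := by
  obtain ⟨z, hz, m, rfl⟩ := h
  refine ⟨(List.range n).map fun i => z (m + i), by simp, z, hz, m + n, ?_⟩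
  rw [List.range_add, List.map_append, List.map_map]
  rfl

theorem mem_follower {w v : List (Fin g)} : v ∈ follower S w ↔ w ++ v ∈ language S :=
  ⟨fun h => h.2, fun h => ⟨language_suffix h, h⟩⟩

/-- This makes the Fischer cover deterministic: the target of an edge does not depend on the word
chosen to represent its source. -/
theorem follower_append_congr {u u' : List (Fin g)} (h : follower S u = follower S u')
    (v : List (Fin g)) : follower S (u ++ v) = follower S (u' ++ v) := by
  ext w
  rw [mem_follower, mem_follower, List.append_assoc, List.append_assoc, ← mem_follower,
    ← mem_follower, h]

/-- The prefix `w` already decouples the past from everything after it, including `v`. Hence nodes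
of the cover lead to nodes. -/
theorem IsSynchronizing.append {w v : List (Fin g)} (hw : IsSynchronizing S w)
    (h : w ++ v ∈ language S) : IsSynchronizing S (w ++ v) := by
  refine ⟨h, fun x hx z _ h1 h2 => ?_⟩
  rw [← List.append_assoc] at h1
  rw [List.append_assoc] at h2
  have := hw.2 x hx (v ++ z) (language_suffix h2) (language_prefix h1) h2
  simpa [List.append_assoc] using this

theorem follower_append_mem_fischerNodes {u v : List (Fin g)}
    (hu : follower S u ∈ fischerNodes S) (h : u ++ v ∈ language S) :
    follower S (u ++ v) ∈ fischerNodes S := by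
  obtain ⟨w, hw, hwu⟩ := hu
  rw [← follower_append_congr hwu]
  rw [← mem_follower, ← hwu, mem_follower] at h
  exact ⟨_, hw.append h, rfl⟩

theorem exists_word_of_fischerNodes (F : fischerNodes S) :
    ∃ u ∈ language S, follower S u = F := by
  obtain ⟨w, hw, h⟩ := F.2
  exact ⟨w, hw.1, h⟩

/-- Edges are defined through some representing word. Since follower sets determine those of all
extensions, any word `u` with follower set `F` can replace it, synchronizing or not. -/
theorem reads_imp {F F' : fischerNodes S} {w : List (Fin g)} (h : (fischerCover S).Reads F w F') :
    ∀ u, follower S u = F → u ∈ language S → u ++ w ∈ language S ∧ follower S (u ++ w) = F' := by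
  induction h with
  | nil F => intro u hF hu; rw [List.append_nil]; exact ⟨hu, hF⟩
  | cons e h ih =>
    intro u hF hu
    obtain ⟨w₀, -, h1, h2, h3⟩ := e.2
    have hF' : follower S u = follower S w₀ := hF.trans h2
    rw [← mem_follower, ← hF', mem_follower] at h1
    have := ih (u ++ [e.1.2.1]) ((follower_append_congr hF' _).trans h3.symm) h1
    rwa [List.append_assoc] at this

theorem reads_of_mem_language {F' : fischerNodes S} {w : List (Fin g)} :
    ∀ {F : fischerNodes S} {u : List (Fin g)}, follower S u = F → u ++ w ∈ language S →
      follower S (u ++ w) = F' → (fischerCover S).Reads F w F' := by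
  induction w with
  | nil =>
    intro F u hF _ hF'
    rw [List.append_nil] at hF'
    obtain rfl : F = F' := Subtype.ext (hF.symm.trans hF')
    exact .nil F
  | cons d w ih =>
    intro F u hF hu hF'
    have e1 : u ++ d :: w = u ++ [d] ++ w := by simp
    rw [e1] at hu hF'
    have hd := language_prefix hu
    have hn : follower S (u ++ [d]) ∈ fischerNodes S :=
      follower_append_mem_fischerNodes (hF ▸ F.2) hd
    exact LabeledGraph.Reads.cons (G := fischerCover S)
      ⟨(F, d, ⟨_, hn⟩), u, language_prefix hd, hd, hF.symm, rfl⟩ (ih rfl hu hF')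

theorem reads_iff {F F' : fischerNodes S} {u w : List (Fin g)} (hF : follower S u = F)
    (hu : u ∈ language S) :
    (fischerCover S).Reads F w F' ↔ u ++ w ∈ language S ∧ follower S (u ++ w) = F' :=
  ⟨fun h => reads_imp h u hF hu, fun h => reads_of_mem_language hF h.1 h.2⟩

theorem reads_unique {F F₁ F₂ : fischerNodes S} {w : List (Fin g)}
    (h₁ : (fischerCover S).Reads F w F₁) (h₂ : (fischerCover S).Reads F w F₂) : F₁ = F₂ := by
  obtain ⟨u, hu, hF⟩ := exists_word_of_fischerNodes F
  exact Subtype.ext ((reads_imp h₁ u hF hu).2.symm.trans (reads_imp h₂ u hF hu).2)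

theorem reads_append_iff {F F' : fischerNodes S} {x w : List (Fin g)} :
    (fischerCover S).Reads F (x ++ w) F' ↔
      ∃ F₁, (fischerCover S).Reads F x F₁ ∧ (fischerCover S).Reads F₁ w F' := by
  obtain ⟨u, hu, hF⟩ := exists_word_of_fischerNodes F
  rw [reads_iff hF hu, ← List.append_assoc]
  constructor
  · rintro ⟨h1, h2⟩
    have hx := language_prefix h1
    have hn : follower S (u ++ x) ∈ fischerNodes S :=
      follower_append_mem_fischerNodes (hF ▸ F.2) hx
    exact ⟨⟨_, hn⟩, (reads_iff hF hu).2 ⟨hx, rfl⟩, (reads_iff rfl hx).2 ⟨h1, h2⟩⟩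
  · rintro ⟨F₁, h1, h2⟩
    obtain ⟨hx, hF₁⟩ := (reads_iff hF hu).1 h1
    exact (reads_iff hF₁ hx).1 h2

theorem mem_fischerEdges_iff {F F' : fischerNodes S} {d : Fin g} :
    (F, d, F') ∈ fischerEdges S ↔ (fischerCover S).Reads F [d] F' := by
  constructor
  · intro h
    exact LabeledGraph.Reads.cons (G := fischerCover S) ⟨(F, d, F'), h⟩ (.nil _)
  · intro h
    obtain ⟨u, hu, hF⟩ := exists_word_of_fischerNodes F
    obtain ⟨h1, h2⟩ := (reads_iff hF hu).1 h
    exact ⟨u, hu, h1, hF.symm, h2.symm⟩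

end Language

/-! ### Counting words read by a regular Fischer cover -/

/-- Existence with uniqueness becomes a sum of indicators; this is how counts of words split over
intermediate states. -/
theorem ite_eq_sum_ite {X : Type*} [Fintype X] {P : Prop} {Q : X → Prop} [Decidable P]
    [∀ s, Decidable (Q s)] (h : P ↔ ∃ s, Q s)
    (huniq : ∀ s t, Q s → Q t → s = t) :
    (if P then (1 : ℝ) else 0) = ∑ s, if Q s then 1 else 0 := by
  by_cases hP : P
  · obtain ⟨s, hs⟩ := h.1 hP
    rw [if_pos hP, Finset.sum_eq_single s, if_pos hs]
    · intro t _ ht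
      exact if_neg fun h' => ht (huniq _ _ h' hs)
    · simp
  · rw [if_neg hP, Finset.sum_eq_zero]
    intro s _
    exact if_neg fun hs => hP (h.2 ⟨s, hs⟩)

theorem ite_and_eq_mul (P Q : Prop) [Decidable P] [Decidable Q] [Decidable (P ∧ Q)] :
    (if P ∧ Q then (1 : ℝ) else 0) = (if P then 1 else 0) * if Q then 1 else 0 := by
  by_cases hP : P <;> by_cases hQ : Q <;> simp [hP, hQ]

theorem sum_words_one (F : List (Fin g) → ℝ) : ∑ w ∈ words g 1, F w = ∑ d : Fin g, F [d] := by
  symm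
  refine Finset.sum_bij (fun d _ => [d]) (by simp) (by simp) ?_ fun _ _ => rfl
  intro w hw
  obtain ⟨d, rfl⟩ := List.length_eq_one_iff.1 (mem_words.1 hw)
  exact ⟨d, Finset.mem_univ _, rfl⟩

section Regular

variable {S : Shift g} [Fintype (fischerNodes S)] {k : ℕ}

open Classical in
theorem ite_reads_append (F F' : fischerNodes S) (x w : List (Fin g)) :
    (if (fischerCover S).Reads F (x ++ w) F' then (1 : ℝ) else 0) =
      ∑ F₁, (if (fischerCover S).Reads F x F₁ then 1 else 0) *
        if (fischerCover S).Reads F₁ w F' then 1 else 0 := by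
  rw [ite_eq_sum_ite reads_append_iff fun _ _ h h' => reads_unique h.1 h'.1]
  simp_rw [ite_and_eq_mul]

open Classical in
-- By determinism a path is given by its start and its label, so the sum counts paths of length `n`
-- into `F'`; the `k` incoming edges at each node give `k ^ n`. This yields the column sums of the
-- transition matrices.
theorem sum_reads_target (hS : (fischerCover S).IsRegular k) (n : ℕ) (F' : fischerNodes S) :
    ∑ w ∈ words g n, ∑ F, (if (fischerCover S).Reads F w F' then (1 : ℝ) else 0) = k ^ n := by
  induction n generalizing F' with
  | zero =>
    have h0 : words g 0 = {[]} := by ext w; simp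
    have h1 : ∀ F : fischerNodes S, (fischerCover S).Reads F [] F' ↔ F = F' :=
      fun F => ⟨fun h => by cases h; rfl, fun h => h ▸ .nil _⟩
    simp only [h0, h1, Finset.sum_singleton, Finset.sum_boole, pow_zero, Nat.cast_eq_one,
      Finset.card_eq_one]
    exact ⟨F', by ext; simp [eq_comm]⟩
  | succ n ih =>
    have h1 : ∀ x w : List (Fin g),
        ∑ F, (if (fischerCover S).Reads F (x ++ w) F' then (1 : ℝ) else 0) =
        ∑ F₁, (∑ F, if (fischerCover S).Reads F x F₁ then (1 : ℝ) else 0) *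
          if (fischerCover S).Reads F₁ w F' then 1 else 0 := by
      intro x w
      simp_rw [ite_reads_append, Finset.sum_mul]
      exact Finset.sum_comm
    have h2 : ∑ w ∈ words g 1, ∑ F₁, (if (fischerCover S).Reads F₁ w F' then (1 : ℝ) else 0) =
        k := by
      rw [sum_words_one]
      simp_rw [← mem_fischerEdges_iff]
      rw [← Fintype.sum_prod_type'
        (f := fun d F₁ => if (F₁, d, F') ∈ fischerEdges S then (1 : ℝ) else 0),
        Finset.sum_boole, ← (hS F').2, ← Fintype.card_subtype, Nat.card_eq_fintype_card.symm]
      congr 1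
      refine (Nat.card_congr ⟨fun e => ⟨(e.1.1.2.1, e.1.1.1), ?mem⟩,
        fun q => ⟨⟨(q.1.2, q.1.1, F'), q.2⟩, rfl⟩, ?_, ?_⟩).symm
      case mem =>
        obtain ⟨⟨⟨F, d, F₁⟩, h⟩, rfl⟩ := e
        exact h
      · rintro ⟨⟨⟨F, d, F₁⟩, h⟩, rfl⟩
        rfl
      · rintro ⟨⟨d, F⟩, h⟩
        rfl
    rw [sum_words_add, Finset.sum_comm]
    simp_rw [h1]
    rw [← Finset.sum_congr rfl fun w _ => Finset.sum_comm, pow_succ]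
    conv_rhs => rw [← h2, Finset.mul_sum]
    refine Finset.sum_congr rfl fun w _ => ?_
    rw [Finset.mul_sum]
    refine Finset.sum_congr rfl fun F₁ _ => ?_
    rw [← Finset.sum_mul, ih, h2]

open Classical in
-- The same count with outgoing edges; it provides the lower bound for the number of restricted
-- integers.
theorem sum_reads_source (hS : (fischerCover S).IsRegular k) (n : ℕ) (F : fischerNodes S) :
    ∑ w ∈ words g n, ∑ F', (if (fischerCover S).Reads F w F' then (1 : ℝ) else 0) = k ^ n := by
  induction n generalizing F with
  | zero =>
    have h0 : words g 0 = {[]} := by ext w; simp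
    have h1 : ∀ F' : fischerNodes S, (fischerCover S).Reads F [] F' ↔ F = F' :=
      fun F' => ⟨fun h => by cases h; rfl, fun h => h ▸ .nil _⟩
    simp only [h0, h1, Finset.sum_singleton, Finset.sum_boole, pow_zero, Nat.cast_eq_one,
      Finset.card_eq_one]
    exact ⟨F, by ext; simp [eq_comm]⟩
  | succ n ih =>
    have h1 : ∀ x w : List (Fin g),
        ∑ F', (if (fischerCover S).Reads F (x ++ w) F' then (1 : ℝ) else 0) =
        ∑ F₁, (if (fischerCover S).Reads F x F₁ then (1 : ℝ) else 0) *
          ∑ F', if (fischerCover S).Reads F₁ w F' then 1 else 0 := by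
      intro x w
      simp_rw [ite_reads_append, Finset.mul_sum]
      exact Finset.sum_comm
    have h2 : ∀ F₁ : fischerNodes S,
        ∑ w ∈ words g 1, ∑ F', (if (fischerCover S).Reads F₁ w F' then (1 : ℝ) else 0) = k := by
      intro F₁
      rw [sum_words_one]
      simp_rw [← mem_fischerEdges_iff]
      rw [← Fintype.sum_prod_type'
        (f := fun d F' => if (F₁, d, F') ∈ fischerEdges S then (1 : ℝ) else 0),
        Finset.sum_boole, ← (hS F₁).1, ← Fintype.card_subtype, Nat.card_eq_fintype_card.symm]
      congr 1
      refine (Nat.card_congr ⟨fun e => ⟨(e.1.1.2.1, e.1.1.2.2), ?mem⟩,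
        fun q => ⟨⟨(F₁, q.1.1, q.1.2), q.2⟩, rfl⟩, ?_, ?_⟩).symm
      case mem =>
        obtain ⟨⟨⟨F, d, F'⟩, h⟩, rfl⟩ := e
        exact h
      · rintro ⟨⟨⟨F, d, F'⟩, h⟩, rfl⟩
        rfl
      · rintro ⟨⟨d, F⟩, h⟩
        rfl
    rw [sum_words_add, pow_succ, ← ih F, Finset.sum_mul]
    refine Finset.sum_congr rfl fun x _ => ?_
    simp_rw [h1]
    rw [Finset.sum_comm, Finset.sum_mul]
    refine Finset.sum_congr rfl fun F₁ _ => ?_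
    rw [← Finset.mul_sum, h2]

end Regular

/-! ### Words of the restricted language by their states -/

/-- The vector of residues of `f(n)`. -/
def residue {r : ℕ} (a : Fin r → ℕ) (f : Fin r → ℕ → ℤ) (n : ℕ) : ∀ j, ZMod (a j) :=
  fun j => ((f j n : ℤ) : ZMod (a j))

theorem congr_iff {r : ℕ} {a : Fin r → ℕ} {f : Fin r → ℕ → ℤ} {n : ℕ} {b : ∀ j, ZMod (a j)} :
    Congr a f n b ↔ residue a f n = b :=
  funext_iff.symm

theorem residue_val_add {r : ℕ} {a : Fin r → ℕ} {f : Fin r → ℕ → ℤ} (hg : 2 ≤ g)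
    (hf : ∀ j, IsGAdditive g (f j)) (x : List (Fin g)) (u : ℕ) :
    residue a f (val x + g ^ x.length * u) =
      residue a f (val x) + residue a f (g ^ x.length * u) := by
  funext j
  simp [residue, (hf j).map_add_mul hg (val_lt x)]

/-- The words of the `ℓ`-restricted language in the state `s`. -/
def IsInState (S : Shift g) {r : ℕ} (a : Fin r → ℕ) (f : Fin r → ℕ → ℤ) (ℓ : ℕ)
    (x : List (Fin g)) (s : State S a) : Prop :=
  x ∈ language S ∧ follower S (x.take ℓ) ∈ fischerNodes S ∧ residue a f (val x) = s.1 ∧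
    follower S x = s.2

section

variable {S : Shift g} {r : ℕ} {a : Fin r → ℕ} {f : Fin r → ℕ → ℤ} {ℓ : ℕ}

theorem IsInState.unique {x : List (Fin g)} {s t : State S a} (hs : IsInState S a f ℓ x s)
    (ht : IsInState S a f ℓ x t) : s = t :=
  Prod.ext (hs.2.2.1.symm.trans ht.2.2.1) (Subtype.ext (hs.2.2.2.symm.trans ht.2.2.2))

theorem exists_isInState {x : List (Fin g)} (hx : x ∈ language S)
    (h : follower S (x.take ℓ) ∈ fischerNodes S) : ∃ s, IsInState S a f ℓ x s := by
  have hn : follower S x ∈ fischerNodes S := by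
    rw [← List.take_append_drop ℓ x]
    exact follower_append_mem_fischerNodes h (by rwa [List.take_append_drop])
  exact ⟨(_, ⟨_, hn⟩), hx, h, rfl, rfl⟩

/-- Once `m ≥ ℓ`, the prefix condition is decided by `x` alone, the residues add, and the follower
set moves along a path of the cover labelled `w`. This is the Markov property behind the recurrence.
-/
theorem isInState_append_iff (hg : 2 ≤ g) (hf : ∀ j, IsGAdditive g (f j)) {m p : ℕ} (hm : ℓ ≤ m)
    {x w : List (Fin g)} (hx : x.length = m) (hw : w.length = p) (s' : State S a) :
    IsInState S a f ℓ (x ++ w) s' ↔ ∃ s, IsInState S a f ℓ x s ∧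
      w ∈ transitionWords S a f p m (s'.1 - s.1) s.2 s'.2 := by
  subst hx hw
  have htake : (x ++ w).take ℓ = x.take ℓ := List.take_append_of_le_length hm
  unfold IsInState transitionWords
  rw [htake, val_append, residue_val_add hg hf]
  constructor
  · rintro ⟨h1, h2, h3, h4⟩
    have hx := language_prefix h1
    obtain ⟨s, hs⟩ := exists_isInState (a := a) (f := f) hx h2
    refine ⟨s, hs, language_suffix h1, rfl, ?_, (reads_iff hs.2.2.2 hx).2 ⟨h1, h4⟩⟩
    rw [congr_iff, eq_sub_iff_add_eq', ← hs.2.2.1, h3]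
  · rintro ⟨s, ⟨h1, h2, h3, h4⟩, -, -, h5, h6⟩
    obtain ⟨h7, h8⟩ := (reads_iff h4 h1).1 h6
    rw [congr_iff] at h5
    exact ⟨h7, h2, by rw [h3, h5]; abel, h8⟩

open Classical in
theorem ncard_transitionWords (p i : ℕ) (b : ∀ j, ZMod (a j)) (F F' : fischerNodes S) :
    ((transitionWords S a f p i b F F').ncard : ℝ) =
      ∑ w ∈ words g p, if w ∈ transitionWords S a f p i b F F' then 1 else 0 := by
  rw [Finset.sum_boole, ← Set.ncard_coe_finset]
  congr 2
  ext w
  simp only [Finset.coe_filter, mem_words, Set.mem_ofPred_eq]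
  exact ⟨fun h => ⟨h.2.1, h⟩, fun h => h.2⟩

theorem mem_transitionWords_iff {p i : ℕ} {b : ∀ j, ZMod (a j)} {F F' : fischerNodes S}
    {w : List (Fin g)} (hw : w.length = p) :
    w ∈ transitionWords S a f p i b F F' ↔
      residue a f (g ^ i * val w) = b ∧ (fischerCover S).Reads F w F' := by
  rw [← congr_iff]
  refine ⟨fun h => h.2.2, fun h => ⟨?_, hw, h⟩⟩
  obtain ⟨u, hu, hF⟩ := exists_word_of_fischerNodes F
  exact language_suffix ((reads_iff hF hu).1 h.2).1

theorem transitionMatrix_add_mul (hg : 2 ≤ g) (hf : ∀ j, IsGAdditive g (f j)) {p : ℕ}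
    (hp : IsEventualPeriod g a f p ℓ) (k n : ℕ) {i : ℕ} (hi : ℓ ≤ i) :
    transitionMatrix S a f k p (i + n * p) = transitionMatrix S a f k p i := by
  have h : ∀ w : List (Fin g),
      residue a f (g ^ (i + n * p) * val w) = residue a f (g ^ i * val w) := fun w =>
    funext fun j => (ZMod.intCast_eq_intCast_iff _ _ _).2 (hp.modEq_val hg hf n w i hi j)
  funext s s'
  unfold transitionMatrix transitionWords
  simp_rw [congr_iff, h]

/-- An integer may have several words, differing by zeros at the high end. As `u > 0`, all of them
begin with `x ++ y`, and the language is closed under prefixes, so testing `x ++ y` suffices. -/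
theorem mem_restrictedIntegers_iff (hg : 2 ≤ g) {u : ℕ} (hu : 0 < u) {x y : List (Fin g)}
    (hx : ℓ ≤ x.length) (hy : val y = u) (hmin : ∀ w : List (Fin g), val w = u → y <+: w) :
    val x + g ^ x.length * u ∈ restrictedIntegers S ℓ ↔
      x ++ y ∈ language S ∧ follower S (x.take ℓ) ∈ fischerNodes S := by
  constructor
  · rintro ⟨w, ⟨h1, -, h2⟩, hw⟩
    obtain ⟨y', rfl, hy'⟩ := exists_eq_append_of_val_eq hg hu hw
    obtain ⟨z, rfl⟩ := hmin y' hy'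
    rw [List.take_append_of_le_length hx] at h2
    rw [← List.append_assoc] at h1
    exact ⟨language_prefix h1, h2⟩
  · rintro ⟨h1, h2⟩
    refine ⟨x ++ y, ⟨h1, ?_, ?_⟩, by rw [val_append, hy]⟩
    · rw [List.length_append]; omega
    · rwa [List.take_append_of_le_length hx]

variable [Fintype (fischerNodes S)]

/-- Extend a synchronizing word to length exactly `ℓ`. From its node there are `k ^ (m - ℓ)` paths
of length `m - ℓ`, whose labels give distinct integers below `g ^ m`. -/
theorem le_count_restrictedIntegers {k : ℕ} (hk : 2 ≤ k)
    (hS : (fischerCover S).IsRegular k) (hsync : ∃ w, IsSynchronizing S w ∧ w.length ≤ ℓ) {m : ℕ}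
    (hm : ℓ ≤ m) : 1 / (k : ℝ) ^ ℓ * (k : ℝ) ^ m ≤ count (restrictedIntegers S ℓ) (g ^ m) := by
  classical
  obtain ⟨w, hw, hwℓ⟩ := hsync
  obtain ⟨v, hv, hwv⟩ := exists_append_mem_language hw.1 (ℓ - w.length)
  set u := w ++ v with hu
  have hulen : u.length = ℓ := by rw [hu, List.length_append]; omega
  have hF : follower S u ∈ fischerNodes S := ⟨u, hw.append hwv, rfl⟩
  obtain ⟨n, rfl⟩ : ∃ n, m = ℓ + n := ⟨m - ℓ, by omega⟩
  have hk0 : (0 : ℝ) < (k : ℝ) ^ ℓ := by positivity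
  rw [pow_add, ← mul_assoc, one_div_mul_cancel hk0.ne', one_mul,
    ← sum_reads_source hS n ⟨_, hF⟩]
  have h1 : ∀ x : List (Fin g), u ++ x ∈ language S ↔
      ∃ F', (fischerCover S).Reads ⟨_, hF⟩ x F' := by
    intro x
    constructor
    · intro h
      exact ⟨⟨_, follower_append_mem_fischerNodes hF h⟩, (reads_iff rfl hwv).2 ⟨h, rfl⟩⟩
    · rintro ⟨F', h⟩
      exact ((reads_iff rfl hwv).1 h).1
  simp_rw [← ite_eq_sum_ite (h1 _) fun _ _ h h' => reads_unique h h']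
  rw [Finset.sum_boole, Nat.cast_le, ← Set.ncard_coe_finset]
  refine Set.ncard_le_ncard_of_injOn (fun x => val (u ++ x)) ?_ ?_
    ((Set.finite_Ico 0 _).subset Set.inter_subset_right)
  · intro x hx
    simp only [Finset.coe_filter, mem_words, Set.mem_ofPred_eq] at hx
    refine ⟨⟨u ++ x, ⟨hx.2, ?_, ?_⟩, rfl⟩, Nat.zero_le _, ?_⟩
    · rw [List.length_append]; omega
    · rwa [List.take_append_of_le_length hulen.ge, List.take_of_length_le hulen.le]
    · have := val_lt (u ++ x)
      rwa [List.length_append, hulen, hx.1] at this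
  · intro x hx x' hx' h
    simp only [Finset.coe_filter, mem_words, Set.mem_ofPred_eq] at hx hx'
    exact List.append_cancel_left (eq_of_val_eq (by simp [hx.1, hx'.1]) h)

variable [∀ j, NeZero (a j)]

/-- A word and the final residue determine the initial residue, so a column counts exactly the paths
of length `p` into the node of `s'`. -/
theorem sum_transitionMatrix {k : ℕ} (hk : 2 ≤ k) (hS : (fischerCover S).IsRegular k) (p i : ℕ)
    (s' : State S a) : ∑ s, transitionMatrix S a f k p i s s' = 1 := by
  classical
  have hk0 : (0 : ℝ) < (k : ℝ) ^ p := by positivity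
  unfold transitionMatrix
  rw [← Finset.mul_sum, inv_mul_eq_one₀ hk0.ne', ← sum_reads_target hS p s'.2]
  simp_rw [ncard_transitionWords]
  symm
  rw [Finset.sum_comm]
  refine Finset.sum_congr rfl fun w hw => ?_
  simp_rw [mem_transitionWords_iff (mem_words.1 hw), ite_and_eq_mul]
  rw [Fintype.sum_prod_type, Finset.sum_comm]
  refine Finset.sum_congr rfl fun F _ => ?_
  have h : ∀ b : ∀ j, ZMod (a j), residue a f (g ^ i * val w) = s'.1 - b ↔
      b = s'.1 - residue a f (g ^ i * val w) := fun b => by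
    rw [eq_sub_iff_add_eq', eq_sub_iff_add_eq]
  by_cases hR : (fischerCover S).Reads F w s'.2 <;> simp [h, hR]

open Classical in
/-- The number of words of length `m` of the restricted language in the state `s`. -/
noncomputable def stateCount (S : Shift g) {r : ℕ} (a : Fin r → ℕ) (f : Fin r → ℕ → ℤ) (ℓ m : ℕ)
    (s : State S a) : ℝ :=
  ∑ x ∈ words g m, if IsInState S a f ℓ x s then 1 else 0

theorem stateCount_add (hg : 2 ≤ g) (hf : ∀ j, IsGAdditive g (f j)) {k : ℕ} (hk : 2 ≤ k) {m : ℕ}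
    (hm : ℓ ≤ m) (p : ℕ) (s' : State S a) :
    stateCount S a f ℓ (m + p) s' =
      (k : ℝ) ^ p * ∑ s, stateCount S a f ℓ m s * transitionMatrix S a f k p m s s' := by
  classical
  have hk0 : (0 : ℝ) < (k : ℝ) ^ p := by positivity
  have h1 : (k : ℝ) ^ p * ∑ s, stateCount S a f ℓ m s * transitionMatrix S a f k p m s s' =
      ∑ s, stateCount S a f ℓ m s *
        (transitionWords S a f p m (s'.1 - s.1) s.2 s'.2).ncard := by
    rw [Finset.mul_sum]
    refine Finset.sum_congr rfl fun s _ => ?_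
    unfold transitionMatrix
    field_simp
  rw [h1]
  simp_rw [ncard_transitionWords, stateCount, sum_words_add, Finset.sum_mul]
  conv_rhs => rw [Finset.sum_comm]
  refine Finset.sum_congr rfl fun x hx => ?_
  simp_rw [Finset.mul_sum]
  rw [Finset.sum_comm]
  refine Finset.sum_congr rfl fun w hw => ?_
  rw [ite_eq_sum_ite (isInState_append_iff hg hf hm (mem_words.1 hx) (mem_words.1 hw) s')
    fun _ _ h h' => h.1.unique h'.1]
  simp_rw [ite_and_eq_mul]

theorem stateCount_add_mul (hg : 2 ≤ g) (hf : ∀ j, IsGAdditive g (f j)) {k : ℕ} (hk : 2 ≤ k)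
    {p : ℕ} (hp : IsEventualPeriod g a f p ℓ) [DecidableEq (State S a)] {m : ℕ} (hm : ℓ ≤ m)
    (n : ℕ) (s' : State S a) :
    stateCount S a f ℓ (m + n * p) s' = (k : ℝ) ^ (n * p) *
      ∑ s, stateCount S a f ℓ m s * (transitionMatrix S a f k p m ^ n) s s' := by
  induction n generalizing s' with
  | zero => simp [Matrix.one_apply]
  | succ n ih =>
    rw [add_mul, one_mul, ← add_assoc, stateCount_add hg hf hk (by omega),
      transitionMatrix_add_mul hg hf hp k n hm, pow_add, mul_comm _ ((k : ℝ) ^ p), mul_assoc]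
    congr 1
    simp_rw [ih, pow_succ, Matrix.mul_apply, mul_assoc]
    rw [← Finset.mul_sum]
    congr 1
    simp_rw [Finset.sum_mul, Finset.mul_sum]
    rw [Finset.sum_comm]
    simp_rw [mul_assoc]

/-! ### The integers of the restricted language -/

theorem exists_sum_deviation_restrictedIntegers (hg : 2 ≤ g) (hf : ∀ j, IsGAdditive g (f j))
    (b : ∀ j, ZMod (a j)) {m : ℕ} (hm : ℓ ≤ m) {u : ℕ} (hu : 0 < u) :
    ∃ z : State S a → ℝ, (∀ s, |z s| ≤ 1) ∧ ∑ s, z s = 0 ∧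
      ∑ n ∈ Finset.Ico (u * g ^ m) ((u + 1) * g ^ m),
        deviation (restrictedIntegers S ℓ) (fun n => Congr a f n b) (1 / ∏ j, (a j : ℝ)) n =
          ∑ s, stateCount S a f ℓ m s * z s := by
  classical
  obtain ⟨y, hy, hmin⟩ := exists_minimal_word hg u
  set κ : ℝ := 1 / ∏ j, (a j : ℝ) with hκ
  have hprod : 1 ≤ ∏ j, (a j : ℝ) := by
    exact_mod_cast Nat.one_le_iff_ne_zero.2
      (Finset.prod_ne_zero_iff.2 fun j _ => NeZero.ne (a j))
  have hκ0 : 0 ≤ κ := by positivity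
  have hκ1 : κ ≤ 1 := (div_le_one (by linarith)).2 hprod
  -- A word in state `s` is continued by `y` precisely when `y` lies in the follower set. For each
  -- such node a single residue hits `b`, so the sum over residues is `1 - (∏ a_j) * κ = 0`.
  set z : State S a → ℝ := fun s => (if y ∈ (s.2 : Set (List (Fin g))) then 1 else 0) *
    ((if s.1 + residue a f (g ^ m * u) = b then 1 else 0) - κ) with hz
  refine ⟨z, fun s => ?_, ?_, ?_⟩
  · simp only [hz]
    rw [abs_le]
    split_ifs <;> constructor <;> linarith
  · rw [Fintype.sum_prod_type, Finset.sum_comm]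
    refine Finset.sum_eq_zero fun F _ => ?_
    simp only [hz]
    have h : ∀ c : ∀ j, ZMod (a j), c + residue a f (g ^ m * u) = b ↔
        c = b - residue a f (g ^ m * u) := fun c => eq_sub_iff_add_eq.symm
    have hcard : (Fintype.card (∀ j, ZMod (a j)) : ℝ) * κ = 1 := by
      rw [Fintype.card_pi, hκ]
      simp only [ZMod.card]
      push_cast
      field_simp
    by_cases hF : y ∈ (F : Set (List (Fin g)))
    · simp only [hF, if_true, one_mul, Finset.sum_sub_distrib, h, Finset.sum_ite_eq',
        Finset.mem_univ, Finset.sum_const, Finset.card_univ, nsmul_eq_mul, hcard, sub_self]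
    · simp only [hF, if_false, zero_mul, Finset.sum_const_zero]
  · rw [sum_block_eq_sum_words (by omega)]
    simp_rw [stateCount, Finset.sum_mul]
    rw [Finset.sum_comm]
    refine Finset.sum_congr rfl fun x hx => ?_
    rw [mem_words] at hx
    subst hx
    have hmem := mem_restrictedIntegers_iff (S := S) hg hu hm hy hmin
    by_cases hs : ∃ s, IsInState S a f ℓ x s
    · obtain ⟨s, hs⟩ := hs
      rw [Finset.sum_eq_single s, if_pos hs, one_mul]
      · simp only [deviation, hz, hmem, congr_iff, residue_val_add hg hf, hs.2.2.1, ← hs.2.2.2,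
          mem_follower, hs.2.1, and_true]
        split_ifs <;> simp
      · intro t _ ht
        rw [if_neg fun h => ht (h.unique hs), zero_mul]
      · simp
    · rw [Finset.sum_eq_zero fun s _ => by rw [if_neg fun h => hs ⟨s, h⟩, zero_mul], deviation,
        if_neg]
      rw [hmem]
      exact fun h => hs (exists_isInState (language_prefix h.1) h.2)

end

/-- Equidistribution of additive functions along the restricted integers of a regular shift. -/
theorem exists_isBigO_restrictedIntegers (hg : 2 ≤ g) {r : ℕ} (a : Fin r → ℕ) [∀ j, NeZero (a j)]
    (f : Fin r → ℕ → ℤ) (hf : ∀ j, IsGAdditive g (f j)) (S : Shift g) (hS : IsSofic S) {k : ℕ}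
    (hk : 2 ≤ k) (hreg : (fischerCover S).IsRegular k) {p ℓ : ℕ}
    (hp : IsEventualPeriod g a f p ℓ) (hsync : ∃ w, IsSynchronizing S w ∧ w.length ≤ ℓ)
    (hM : MarkovCondition S hS a f k p ℓ) :
    ∃ γ : ℝ, 0 < γ ∧ ∀ b : (∀ j, ZMod (a j)),
      (fun N : ℕ => (count {n | n ∈ restrictedIntegers S ℓ ∧ Congr a f n b} N : ℝ) /
        count (restrictedIntegers S ℓ) N - 1 / ∏ j, (a j : ℝ))
        =O[atTop] fun N : ℕ => (N : ℝ) ^ (-γ) := by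
  classical
  have : Finite (fischerNodes S) := finite_fischerNodes hS
  let _ : Fintype (fischerNodes S) := Fintype.ofFinite _
  have : Nonempty (fischerNodes S) := by
    obtain ⟨w, hw, -⟩ := hsync
    exact ⟨⟨_, w, hw, rfl⟩⟩
  have hprim : ∀ i ≥ ℓ, ∀ᶠ n in atTop, ∀ s s' : State S a,
      0 < (transitionMatrix S a f k p i ^ n) s s' := by
    intro i hi
    have h := hM i hi
    have h' : IsAperiodicMatrix (transitionMatrix S a f k p i) := by
      convert h.2
    exact eventually_pow_pos h.1 h'
  have hp0 : 0 < p := hp.1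
  have : Nonempty (Fin p) := ⟨⟨0, hp0⟩⟩
  -- By periodicity the positions `ℓ, …, ℓ + p - 1` represent all matrices. One exponent `n` makes
  -- all their powers positive, and the smallest entry obtained next is the uniform `ε`.
  obtain ⟨n, hn, hn0⟩ := ((eventually_all.2 fun i : Fin p => hprim (ℓ + i) (by omega)).and
    (eventually_gt_atTop 0)).exists
  obtain ⟨⟨i₀, s₀, s₁⟩, hmin⟩ := Finite.exists_min fun q : Fin p × State S a × State S a =>
    (transitionMatrix S a f k p (ℓ + q.1) ^ n) q.2.1 q.2.2
  obtain ⟨γ, hγ, h⟩ := exists_isBigO_of_recurrence hg hk (stateCount S a f ℓ)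
    (Nat.mul_pos hn0 hp0) (hn i₀ s₀ s₁) (fun m => transitionMatrix S a f k p m ^ n) (ℓ := ℓ)
    (fun m hm s s' => by
      have h1 : m = ℓ + (m - ℓ) % p + (m - ℓ) / p * p := by
        have := Nat.mod_add_div' (m - ℓ) p
        omega
      rw [h1, transitionMatrix_add_mul hg hf hp k _ (Nat.le_add_right _ _)]
      exact hmin (⟨(m - ℓ) % p, Nat.mod_lt _ hp0⟩, s, s'))
    (fun m _ s' => sum_pow_apply_eq_one (sum_transitionMatrix hk hreg p m) n s')
    (fun m hm s' => stateCount_add_mul hg hf hk hp hm n s')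
    (restrictedIntegers S ℓ) (c := 1 / (k : ℝ) ^ ℓ) (by positivity)
    (fun m hm => le_count_restrictedIntegers hk hreg hsync hm)
  exact ⟨γ, hγ, fun b => h _ _ fun m hm u hu =>
    exists_sum_deviation_restrictedIntegers hg hf b hm hu⟩

/-! ### Words with digits in a set -/

/-- The sum of the letters of a word. -/
def letterSum (w : List (Fin g)) : ℕ := (w.map fun d : Fin g => (d : ℕ)).sum

theorem letterSum_cons (d : Fin g) (w : List (Fin g)) :
    letterSum (d :: w) = d + letterSum w := by
  simp [letterSum]

theorem letterSum_append (x w : List (Fin g)) :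
    letterSum (x ++ w) = letterSum x + letterSum w := by
  simp [letterSum]

theorem digitSum_val (hg : 2 ≤ g) (w : List (Fin g)) : digitSum g (val w) = letterSum w := by
  rw [digitSum, val_eq_ofDigits_map, letterSum]
  refine Nat.sum_digits_ofDigits_eq_sum (by omega) (l := w.length) ⟨by simp, fun d hd => ?_⟩
  obtain ⟨e, -, rfl⟩ := List.mem_map.1 hd
  exact e.isLt

/-- All letters of the word are in `D`. -/
def IsWordIn (D : Finset ℕ) (w : List (Fin g)) : Prop := ∀ d ∈ w, (d : ℕ) ∈ D

theorem isWordIn_append {D : Finset ℕ} {x w : List (Fin g)} :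
    IsWordIn D (x ++ w) ↔ IsWordIn D x ∧ IsWordIn D w :=
  List.forall_mem_append

open Classical in
theorem sum_isWordIn {D : Finset ℕ} (hD : ∀ d ∈ D, d < g) (n : ℕ) :
    ∑ w ∈ words g n, (if IsWordIn D w then (1 : ℝ) else 0) = (D.card : ℝ) ^ n := by
  induction n with
  | zero =>
    have h0 : words g 0 = {[]} := by ext w; simp
    simp [h0, IsWordIn]
  | succ n ih =>
    have h1 : ∑ w ∈ words g 1, (if IsWordIn D w then (1 : ℝ) else 0) = D.card := by
      rw [sum_words_one]
      simp only [IsWordIn, List.mem_singleton, forall_eq]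
      rw [Finset.sum_boole, Nat.cast_inj]
      refine Finset.card_bij (fun d _ => (d : ℕ)) (by simp) (fun d _ e _ h => Fin.ext h) ?_
      exact fun d hd => ⟨⟨d, hD d hd⟩, by simpa using hd, rfl⟩
    rw [sum_words_add, pow_succ, ← ih, ← h1, Finset.sum_mul_sum]
    simp_rw [isWordIn_append, ite_and_eq_mul]

theorem mem_missingDigits_iff {D : Finset ℕ} (hD : ∀ d ∈ D, d < g) {n : ℕ} :
    n ∈ missingDigits g D ↔ ∃ w : List (Fin g), w ≠ [] ∧ IsWordIn D w ∧ val w = n := by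
  constructor
  · rintro ⟨l, h1, h2, rfl⟩
    obtain ⟨w, rfl⟩ := exists_map_eq_of_lt fun d hd => hD d (h2 d hd)
    exact ⟨w, by simpa using h1, fun d hd => h2 d (List.mem_map_of_mem hd),
      val_eq_ofDigits_map w⟩
  · rintro ⟨w, h1, h2, rfl⟩
    refine ⟨_, by simpa using h1, fun d hd => ?_, val_eq_ofDigits_map w⟩
    obtain ⟨e, he, rfl⟩ := List.mem_map.1 hd
    exact h2 e he

theorem val_add_mem_missingDigits_iff (hg : 2 ≤ g) {D : Finset ℕ} (hD : ∀ d ∈ D, d < g) {u : ℕ}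
    (hu : 0 < u) {x y : List (Fin g)} (hy : val y = u)
    (hmin : ∀ w : List (Fin g), val w = u → y <+: w) :
    val x + g ^ x.length * u ∈ missingDigits g D ↔ IsWordIn D x ∧ IsWordIn D y := by
  rw [mem_missingDigits_iff hD]
  constructor
  · rintro ⟨w, -, h1, hw⟩
    obtain ⟨y', rfl, hy'⟩ := exists_eq_append_of_val_eq hg hu hw
    obtain ⟨z, rfl⟩ := hmin y' hy'
    rw [isWordIn_append, isWordIn_append] at h1
    exact ⟨h1.1, h1.2.1⟩
  · intro h
    refine ⟨x ++ y, ?_, isWordIn_append.2 h, by rw [val_append, hy]⟩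
    rintro h'
    obtain ⟨-, rfl⟩ := List.append_eq_nil_iff.1 h'
    simp at hy
    omega

/-! ### The walk of residues -/

/-- The residues of the integer and of the digit sum contributed by the word `w` when it is placed
at position `m`. -/
def increment (a a' m : ℕ) (w : List (Fin g)) : ZMod a × ZMod a' :=
  ((g ^ m * val w : ℕ), (letterSum w : ℕ))

section

variable {a a' : ℕ}

theorem increment_append (m : ℕ) (x w : List (Fin g)) :
    increment a a' m (x ++ w) = increment a a' m x + increment a a' (m + x.length) w := by
  simp only [increment, val_append, letterSum_append, Prod.mk_add_mk]
  push_cast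
  rw [pow_add, mul_add, mul_assoc]

theorem increment_of_pow_eq_one {m : ℕ} (h : (g : ZMod a) ^ m = 1) (w : List (Fin g)) :
    increment a a' m w = increment a a' 0 w := by
  simp [increment, h]

theorem residues_val_add (hg : 2 ≤ g) (x y : List (Fin g)) :
    (((val x + g ^ x.length * val y : ℕ) : ZMod a),
      (digitSum g (val x + g ^ x.length * val y) : ZMod a')) =
      increment a a' 0 x + increment a a' x.length y := by
  rw [← val_append, digitSum_val hg]
  have := increment_append (a := a) (a' := a') 0 x y
  rw [zero_add] at this
  rw [← this]
  simp [increment]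

theorem mem_zmultiples_of_dvd {δ n : ℕ} (h : δ ∣ n) :
    (n : ZMod a) ∈ AddSubgroup.zmultiples (δ : ZMod a) := by
  obtain ⟨q, rfl⟩ := h
  rw [AddSubgroup.mem_zmultiples_iff]
  exact ⟨q, by push_cast; simp [mul_comm]⟩

theorem IsWordIn.increment_mem {D : Finset ℕ} {δ₁ δ₂ : ℕ} (h₁ : ∀ d ∈ D, δ₁ ∣ d)
    (h₂ : ∀ d ∈ D, δ₂ ∣ d) {w : List (Fin g)} (hw : IsWordIn D w) (m : ℕ) :
    increment a a' m w ∈ (AddSubgroup.zmultiples (δ₁ : ZMod a)).prod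
      (AddSubgroup.zmultiples (δ₂ : ZMod a')) := by
  have key : δ₁ ∣ val w ∧ δ₂ ∣ letterSum w := by
    induction w with
    | nil => simp [letterSum]
    | cons d w ih =>
      obtain ⟨h3, h4⟩ := ih fun e he => hw e (List.mem_cons_of_mem _ he)
      have hd := hw d List.mem_cons_self
      rw [val_cons, letterSum_cons]
      exact ⟨dvd_add (h₁ d hd) (h3.mul_left _), dvd_add (h₂ d hd) h4⟩
  exact ⟨mem_zmultiples_of_dvd (key.1.mul_left _), mem_zmultiples_of_dvd key.2⟩

/-- As `g ^ p = 1` modulo `a`, increments of blocks of length `p` do not depend on the block's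
position. The block `d d₁ ⋯ d₁` contributes `β + (d - d₁, d - d₁)`, with `β` the increment of `d₁ ⋯
d₁`. Concatenation realizes sums of differences, and extra blocks `d₁ ⋯ d₁` change only the multiple
of `β`. -/
theorem exists_increment_eq_of_mem_closure {D : Finset ℕ} (hD : ∀ d ∈ D, d < g) {d₁ : ℕ}
    (hd₁ : d₁ ∈ D) (hmin : ∀ d ∈ D, d₁ ≤ d) {p : ℕ} (hp : 0 < p) (hgp : (g : ZMod a) ^ p = 1) :
    ∃ β : ZMod a × ZMod a', (∃ w : List (Fin g), IsWordIn D w ∧ increment a a' 0 w = β) ∧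
      ∀ z ∈ AddSubmonoid.closure
        {e : ZMod a × ZMod a' | ∃ d ∈ D, e = (((d - d₁ : ℕ) : ZMod a), ((d - d₁ : ℕ) : ZMod a'))},
        ∃ K₀ : ℕ, ∀ K ≥ K₀, ∃ w : List (Fin g), w.length = K * p ∧ IsWordIn D w ∧
          increment a a' 0 w = K • β + z := by
  set r : List (Fin g) := List.replicate (p - 1) ⟨d₁, hD d₁ hd₁⟩ with hr
  have hrD : IsWordIn D r := by
    intro d hd
    rw [List.eq_of_mem_replicate hd]
    exact hd₁
  have hblock : ∀ d (hd : d ∈ D), IsWordIn D (⟨d, hD d hd⟩ :: r) := by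
    intro d hd e he
    rcases List.mem_cons.1 he with rfl | he
    · exact hd
    · exact hrD e he
  set β : ZMod a × ZMod a' := increment a a' 0 (⟨d₁, hD d₁ hd₁⟩ :: r) with hβ
  have hinc : ∀ d (hd : d ∈ D), increment a a' 0 (⟨d, hD d hd⟩ :: r) =
      β + (((d - d₁ : ℕ) : ZMod a), ((d - d₁ : ℕ) : ZMod a')) := by
    intro d hd
    rw [hβ]
    simp only [increment, val_cons, letterSum_cons, Prod.mk_add_mk, pow_zero, one_mul]
    push_cast [Nat.cast_sub (hmin d hd)]
    ext <;> simp <;> ring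
  have hadd : ∀ {K K' : ℕ} {z z' : ZMod a × ZMod a'},
      (∃ w : List (Fin g), w.length = K * p ∧ IsWordIn D w ∧ increment a a' 0 w = K • β + z) →
      (∃ w : List (Fin g), w.length = K' * p ∧ IsWordIn D w ∧ increment a a' 0 w = K' • β + z') →
      ∃ w : List (Fin g), w.length = (K + K') * p ∧ IsWordIn D w ∧
        increment a a' 0 w = (K + K') • β + (z + z') := by
    rintro K K' z z' ⟨w, h1, h2, h3⟩ ⟨w', h1', h2', h3'⟩
    refine ⟨w ++ w', by rw [List.length_append, h1, h1', add_mul], isWordIn_append.2 ⟨h2, h2'⟩, ?_⟩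
    have h4 : (g : ZMod a) ^ (0 + w.length) = 1 := by
      rw [zero_add, h1, mul_comm, pow_mul, hgp, one_pow]
    rw [increment_append, increment_of_pow_eq_one h4, h3, h3', add_smul]
    abel
  have hzero : ∀ K : ℕ, ∃ w : List (Fin g), w.length = K * p ∧ IsWordIn D w ∧
      increment a a' 0 w = K • β + 0 := by
    intro K
    induction K with
    | zero => exact ⟨[], by simp, by simp [IsWordIn], by simp [increment, letterSum]⟩
    | succ K ih =>
      have h1 : ∃ w : List (Fin g), w.length = 1 * p ∧ IsWordIn D w ∧
          increment a a' 0 w = 1 • β + 0 :=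
        ⟨_, by rw [List.length_cons, hr, List.length_replicate]; omega, hblock d₁ hd₁, by simp [β]⟩
      simpa using hadd ih h1
  have hlift : ∀ {K : ℕ} {z : ZMod a × ZMod a'},
      (∃ w : List (Fin g), w.length = K * p ∧ IsWordIn D w ∧ increment a a' 0 w = K • β + z) →
      ∀ K' ≥ K, ∃ w : List (Fin g), w.length = K' * p ∧ IsWordIn D w ∧
        increment a a' 0 w = K' • β + z := by
    intro K z h K' hK
    have := hadd h (hzero (K' - K))
    rwa [add_zero, Nat.add_sub_cancel' hK] at this
  refine ⟨β, ⟨_, hblock d₁ hd₁, rfl⟩, fun z hz => ?_⟩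
  suffices h : ∃ K : ℕ, ∃ w : List (Fin g), w.length = K * p ∧ IsWordIn D w ∧
      increment a a' 0 w = K • β + z by
    obtain ⟨K, h⟩ := h
    exact ⟨K, hlift h⟩
  induction hz using AddSubmonoid.closure_induction with
  | mem z hz =>
    obtain ⟨d, hd, rfl⟩ := hz
    exact ⟨1, ⟨d, hD d hd⟩ :: r, by rw [List.length_cons, hr, List.length_replicate]; omega,
      hblock d hd,
      by rw [hinc d hd, one_smul]⟩
  | zero => exact ⟨0, hzero 0⟩
  | add z z' _ _ h h' =>
    obtain ⟨K, h⟩ := h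
    obtain ⟨K', h'⟩ := h'
    exact ⟨K + K', hadd h h'⟩

/-- The pairs `(d - d₁, d - d₁)` generate the product of the subgroups generated by the greatest
common divisors. -/
theorem prod_zmultiples_le_closure (haa' : Nat.Coprime a a') {D : Finset ℕ} {d₁ δ : ℕ}
    (hδ : δ = Nat.gcd (a * a') (D.gcd fun d => d - d₁)) :
    (AddSubgroup.zmultiples ((Nat.gcd δ a : ℕ) : ZMod a)).prod
      (AddSubgroup.zmultiples ((Nat.gcd δ a' : ℕ) : ZMod a')) ≤ AddSubgroup.closure
        {e : ZMod a × ZMod a' |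
          ∃ d ∈ D, e = (((d - d₁ : ℕ) : ZMod a), ((d - d₁ : ℕ) : ZMod a'))} := by
  set T := AddSubgroup.closure {e : ZMod a × ZMod a' |
    ∃ d ∈ D, e = (((d - d₁ : ℕ) : ZMod a), ((d - d₁ : ℕ) : ZMod a'))} with hT
  set φ : ℤ →+ ZMod a × ZMod a' :=
    (Int.castAddHom (ZMod a)).prod (Int.castAddHom (ZMod a')) with hφ
  have hφ' : ∀ n : ℤ, φ n = ((n : ZMod a), (n : ZMod a')) := fun n => rfl
  -- The integers mapped into `T` form a cyclic group `cℤ`. It contains `a * a'` and all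
  -- differences, so `c` divides their gcd `δ`.
  have hδT : φ δ ∈ T := by
    obtain ⟨c, hc⟩ := Int.subgroup_cyclic (T.comap φ)
    rw [← AddSubgroup.zmultiples_eq_closure] at hc
    have hdvd : ∀ n : ℤ, φ n ∈ T ↔ c ∣ n := fun n => by
      rw [← AddSubgroup.mem_comap, hc, Int.mem_zmultiples_iff]
    rw [hdvd, hδ, Int.dvd_natCast]
    refine Nat.dvd_gcd ?_ (Finset.dvd_gcd fun d hd => ?_)
    · rw [← Int.dvd_natCast, ← hdvd, hφ']
      push_cast
      simp only [ZMod.natCast_self, zero_mul, mul_zero]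
      exact T.zero_mem
    · rw [← Int.dvd_natCast, ← hdvd, hφ']
      exact AddSubgroup.subset_closure ⟨d, hd, by simp⟩
  rintro ⟨h₁, h₂⟩ ⟨H₁, H₂⟩
  obtain ⟨q₁, H₁⟩ := AddSubgroup.mem_zmultiples_iff.1 H₁
  obtain ⟨q₂, H₂⟩ := AddSubgroup.mem_zmultiples_iff.1 H₂
  simp only at H₁ H₂
  have hbez : ∀ n : ℕ, ((Nat.gcd δ n : ℕ) : ZMod n) = (δ : ZMod n) * (Nat.gcdA δ n : ℤ) := by
    intro n
    have := congrArg (Int.cast : ℤ → ZMod n) (Nat.gcd_eq_gcd_ab δ n)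
    push_cast at this
    simpa using this
  have hcop : IsCoprime (a : ℤ) (a' : ℤ) := Nat.isCoprime_iff_coprime.2 haa'
  -- Chinese remaindering: `t * a'` is `1` modulo `a` and `0` modulo `a'`, and `s * a` the reverse.
  -- With `hbez`, a suitable integer multiple of `δ` attains both coordinates.
  obtain ⟨s, t, hst⟩ := hcop
  set n₁ : ℤ := q₁ * Nat.gcdA δ a with hn₁
  set n₂ : ℤ := q₂ * Nat.gcdA δ a' with hn₂
  have e1 : ((t * a' : ℤ) : ZMod a) = 1 := by
    have := congrArg (Int.cast : ℤ → ZMod a) hst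
    simpa using this
  have e2 : ((s * a : ℤ) : ZMod a') = 1 := by
    have := congrArg (Int.cast : ℤ → ZMod a') hst
    simpa using this
  have hmem := T.zsmul_mem hδT (n₁ * (t * a') + n₂ * (s * a))
  convert hmem using 1
  rw [← map_zsmul, hφ', smul_eq_mul]
  refine Prod.ext ?_ ?_
  · rw [← H₁, hbez]
    have : (((n₁ * (t * a') + n₂ * (s * a)) * δ : ℤ) : ZMod a) =
        n₁ * ((t * a' : ℤ) : ZMod a) * δ := by
      push_cast
      simp
    rw [this, e1, hn₁]
    push_cast
    simp
    ring
  · rw [← H₂, hbez]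
    have : (((n₁ * (t * a') + n₂ * (s * a)) * δ : ℤ) : ZMod a') =
        n₂ * ((s * a : ℤ) : ZMod a') * δ := by
      push_cast
      simp
    rw [this, e2, hn₂]
    push_cast
    simp
    ring

/-- The factors have orders `a / gcd(δ, a)` and `a' / gcd(δ, a')`, and the two gcds multiply to `δ`
because `a`, `a'` are coprime and `δ ∣ a * a'`. -/
theorem card_prod_zmultiples (ha : 1 ≤ a) (ha' : 1 ≤ a') (haa' : Nat.Coprime a a') {δ : ℕ}
    (hδ : δ ∣ a * a') :
    Nat.card ((AddSubgroup.zmultiples ((Nat.gcd δ a : ℕ) : ZMod a)).prod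
      (AddSubgroup.zmultiples ((Nat.gcd δ a' : ℕ) : ZMod a')) :
        AddSubgroup (ZMod a × ZMod a')) * δ = a * a' := by
  have h1 : ∀ n : ℕ, 1 ≤ n → Nat.card (AddSubgroup.zmultiples ((Nat.gcd δ n : ℕ) : ZMod n)) *
      Nat.gcd δ n = n := by
    intro n hn
    rw [Nat.card_zmultiples, ZMod.addOrderOf_coe _ (by omega),
      Nat.gcd_eq_right (Nat.gcd_dvd_right δ n)]
    exact Nat.div_mul_cancel (Nat.gcd_dvd_right δ n)
  have h2 : Nat.gcd δ a * Nat.gcd δ a' = δ := by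
    rw [← Nat.Coprime.gcd_mul δ haa', Nat.gcd_eq_left hδ]
  rw [Nat.card_congr (AddSubgroup.prodEquiv _ _).toEquiv, Nat.card_prod]
  calc _ = Nat.card (AddSubgroup.zmultiples ((Nat.gcd δ a : ℕ) : ZMod a)) *
      Nat.card (AddSubgroup.zmultiples ((Nat.gcd δ a' : ℕ) : ZMod a')) *
        (Nat.gcd δ a * Nat.gcd δ a') := by rw [h2]
    _ = (Nat.card (AddSubgroup.zmultiples ((Nat.gcd δ a : ℕ) : ZMod a)) * Nat.gcd δ a) *
      (Nat.card (AddSubgroup.zmultiples ((Nat.gcd δ a' : ℕ) : ZMod a')) * Nat.gcd δ a') := by ring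
    _ = a * a' := by rw [h1 a ha, h1 a' ha']

end

/-! ### The random walk on the subgroup of residues -/

section

variable {a a' : ℕ} {D : Finset ℕ}

/-- With enough digits, every element of a subgroup containing all increments is the increment of
a word, provided that the differences of the digits generate it. -/
theorem exists_length_forall_increment_eq [NeZero a] [NeZero a'] (hga : Nat.Coprime g a)
    (hD : ∀ d ∈ D, d < g) {d₁ : ℕ} (hd₁ : d₁ ∈ D) (hmin : ∀ d ∈ D, d₁ ≤ d)
    {H : AddSubgroup (ZMod a × ZMod a')}
    (hinc : ∀ w : List (Fin g), IsWordIn D w → increment a a' 0 w ∈ H)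
    (hH : H ≤ AddSubgroup.closure {e : ZMod a × ZMod a' |
      ∃ d ∈ D, e = (((d - d₁ : ℕ) : ZMod a), ((d - d₁ : ℕ) : ZMod a'))}) :
    ∃ L > 0, ∀ h ∈ H, ∃ w : List (Fin g), w.length = L ∧ IsWordIn D w ∧
      increment a a' 0 w = h := by
  have hp : 0 < Nat.totient a := Nat.totient_pos.2 (Nat.pos_of_ne_zero (NeZero.ne a))
  have hgp : (g : ZMod a) ^ Nat.totient a = 1 := by
    have := (ZMod.natCast_eq_natCast_iff _ _ _).2 (Nat.ModEq.pow_totient hga)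
    simpa using this
  obtain ⟨β, ⟨w₀, hw₀, rfl⟩, h⟩ :=
    exists_increment_eq_of_mem_closure (a' := a') hD hd₁ hmin hp hgp
  have hev : ∀ᶠ K in atTop, ∀ z : H, ∃ w : List (Fin g), w.length = K * Nat.totient a ∧
      IsWordIn D w ∧ increment a a' 0 w = K • increment a a' 0 w₀ + z := by
    rw [eventually_all]
    intro z
    rw [eventually_atTop]
    refine h z ?_
    -- In a finite group negatives are multiples, so sums of differences alone already fill the
    -- generated subgroup.
    rw [← AddSubgroup.closure_toAddSubmonoid_of_finite]
    exact hH z.2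
  obtain ⟨K, hK, hK0⟩ := (hev.and (eventually_gt_atTop 0)).exists
  refine ⟨K * Nat.totient a, Nat.mul_pos hK0 hp, fun z hz => ?_⟩
  obtain ⟨w, h1, h2, h3⟩ := hK ⟨z - K • increment a a' 0 w₀,
    H.sub_mem hz (H.nsmul_mem (hinc w₀ hw₀) K)⟩
  exact ⟨w, h1, h2, by rw [h3]; simp⟩

/-- Moving a word to position `m` multiplies its first residue by the unit `g ^ m`, which preserves
`⟨δ₁⟩`, and leaves the digit sum unchanged. Thus the same length `L` works at every position. -/
theorem exists_increment_eq_of_coprime (hga : Nat.Coprime g a) {δ₁ δ₂ L : ℕ}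
    (h : ∀ z ∈ (AddSubgroup.zmultiples (δ₁ : ZMod a)).prod (AddSubgroup.zmultiples (δ₂ : ZMod a')),
      ∃ w : List (Fin g), w.length = L ∧ IsWordIn D w ∧ increment a a' 0 w = z) (m : ℕ) :
    ∀ z ∈ (AddSubgroup.zmultiples (δ₁ : ZMod a)).prod (AddSubgroup.zmultiples (δ₂ : ZMod a')),
      ∃ w : List (Fin g), w.length = L ∧ IsWordIn D w ∧ increment a a' m w = z := by
  rintro ⟨z₁, z₂⟩ ⟨hz₁, hz₂⟩
  set e : (ZMod a)ˣ := ZMod.unitOfCoprime g hga ^ m with he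
  have hge : (g : ZMod a) ^ m = e := by rw [he]; simp
  have hz : ((e⁻¹ : (ZMod a)ˣ) : ZMod a) * z₁ ∈ AddSubgroup.zmultiples (δ₁ : ZMod a) := by
    obtain ⟨q, hq⟩ := AddSubgroup.mem_zmultiples_iff.1 hz₁
    obtain ⟨n, hn⟩ := ZMod.intCast_surjective ((e⁻¹ : (ZMod a)ˣ) : ZMod a)
    rw [AddSubgroup.mem_zmultiples_iff]
    refine ⟨n * q, ?_⟩
    simp only at hq
    rw [← hn, ← hq, zsmul_eq_mul, zsmul_eq_mul, Int.cast_mul, mul_assoc]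
  obtain ⟨w, h1, h2, h3⟩ := h (_, z₂) ⟨hz, hz₂⟩
  refine ⟨w, h1, h2, ?_⟩
  rw [increment, Prod.mk.injEq] at h3 ⊢
  refine ⟨?_, h3.2⟩
  have h4 : ((val w : ℕ) : ZMod a) = ((e⁻¹ : (ZMod a)ˣ) : ZMod a) * z₁ := by
    rw [← h3.1, pow_zero, one_mul]
  push_cast
  rw [hge, h4, Units.mul_inv_cancel_left]

theorem pow_card_le_count_missingDigits (hD : ∀ d ∈ D, d < g) {m : ℕ} (hm : 1 ≤ m) :
    (D.card : ℝ) ^ m ≤ count (missingDigits g D) (g ^ m) := by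
  classical
  rw [← sum_isWordIn hD, Finset.sum_boole, Nat.cast_le, ← Set.ncard_coe_finset]
  refine Set.ncard_le_ncard_of_injOn val ?_ ?_
    ((Set.finite_Ico 0 _).subset Set.inter_subset_right)
  · intro x hx
    simp only [Finset.coe_filter, mem_words, Set.mem_ofPred_eq] at hx
    refine ⟨(mem_missingDigits_iff hD).2 ⟨x, ?_, hx.2, rfl⟩, Nat.zero_le _, ?_⟩
    · rintro rfl
      simp at hx
      omega
    · rw [← hx.1]
      exact val_lt x
  · intro x hx x' hx' h
    simp only [Finset.coe_filter, mem_words, Set.mem_ofPred_eq] at hx hx'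
    exact eq_of_val_eq (hx.1.trans hx'.1.symm) h

open Classical in
/-- The number of words of length `m` with digits in `D` and with residues `s`. -/
noncomputable def wordCount (g : ℕ) (D : Finset ℕ) (H : AddSubgroup (ZMod a × ZMod a')) (m : ℕ)
    (s : H) : ℝ :=
  ∑ x ∈ words g m, if IsWordIn D x ∧ increment a a' 0 x = s then 1 else 0

open Classical in
/-- The probability that `L` random digits at position `m` lead from `s` to `s'`. -/
noncomputable def stepProbability (g : ℕ) (D : Finset ℕ) (H : AddSubgroup (ZMod a × ZMod a'))
    (L m : ℕ) (s s' : H) : ℝ :=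
  ((D.card : ℝ) ^ L)⁻¹ *
    ∑ w ∈ words g L, if IsWordIn D w ∧ increment a a' m w = s' - s then 1 else 0

variable {H : AddSubgroup (ZMod a × ZMod a')} [Fintype H]

theorem wordCount_add (hD0 : D.Nonempty)
    (hinc : ∀ w : List (Fin g), IsWordIn D w → ∀ m, increment a a' m w ∈ H) (m L : ℕ) (s' : H) :
    wordCount g D H (m + L) s' =
      (D.card : ℝ) ^ L * ∑ s, wordCount g D H m s * stepProbability g D H L m s s' := by
  classical
  have hk0 : (0 : ℝ) < (D.card : ℝ) ^ L := pow_pos (by exact_mod_cast hD0.card_pos) _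
  have h1 : (D.card : ℝ) ^ L * ∑ s, wordCount g D H m s * stepProbability g D H L m s s' =
      ∑ s, wordCount g D H m s *
        ∑ w ∈ words g L, if IsWordIn D w ∧ increment a a' m w = s' - s then 1 else 0 := by
    rw [Finset.mul_sum]
    refine Finset.sum_congr rfl fun s _ => ?_
    unfold stepProbability
    field_simp
  rw [h1]
  simp_rw [wordCount, sum_words_add, Finset.sum_mul]
  conv_rhs => rw [Finset.sum_comm]
  refine Finset.sum_congr rfl fun x hx => ?_
  simp_rw [Finset.mul_sum]
  rw [Finset.sum_comm]
  refine Finset.sum_congr rfl fun w hw => ?_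
  rw [mem_words] at hx
  subst hx
  have h2 : IsWordIn D (x ++ w) ∧ increment a a' 0 (x ++ w) = s' ↔
      ∃ s : H, (IsWordIn D x ∧ increment a a' 0 x = s) ∧
        (IsWordIn D w ∧ increment a a' x.length w = s' - s) := by
    rw [isWordIn_append, increment_append, zero_add]
    constructor
    · rintro ⟨⟨h3, h4⟩, h5⟩
      exact ⟨⟨_, hinc x h3 0⟩, ⟨h3, rfl⟩, h4, eq_sub_of_add_eq' h5⟩
    · rintro ⟨s, ⟨h3, h4⟩, h5, h6⟩
      exact ⟨⟨h3, h5⟩, by rw [h4, h6]; abel⟩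
  rw [ite_eq_sum_ite h2 fun s t hs ht => Subtype.ext (hs.1.2.symm.trans ht.1.2)]
  simp_rw [ite_and_eq_mul]

/-- Each word over `D` leads to `s'` from exactly one state, namely `s'` minus its increment, which
lies in `H`. -/
theorem sum_stepProbability (hD : ∀ d ∈ D, d < g) (hD0 : D.Nonempty)
    (hinc : ∀ w : List (Fin g), IsWordIn D w → ∀ m, increment a a' m w ∈ H) (L m : ℕ) (s' : H) :
    ∑ s, stepProbability g D H L m s s' = 1 := by
  classical
  have hk0 : (0 : ℝ) < (D.card : ℝ) ^ L := pow_pos (by exact_mod_cast hD0.card_pos) _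
  unfold stepProbability
  rw [← Finset.mul_sum, inv_mul_eq_one₀ hk0.ne', ← sum_isWordIn hD L]
  symm
  rw [Finset.sum_comm]
  refine Finset.sum_congr rfl fun w _ => ?_
  symm
  refine ite_eq_sum_ite ⟨fun h => ?_, fun ⟨s, h, _⟩ => h⟩ fun s t hs ht => ?_
  · exact ⟨⟨s' - increment a a' m w, H.sub_mem s'.2 (hinc w h m)⟩, h, by simp⟩
  · exact Subtype.ext (sub_right_injective (hs.2.symm.trans ht.2))

theorem exists_sum_deviation_missingDigits (hg : 2 ≤ g) (hD : ∀ d ∈ D, d < g)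
    (hinc : ∀ w : List (Fin g), IsWordIn D w → ∀ m, increment a a' m w ∈ H)
    {b : ZMod a} {b' : ZMod a'} (hb : (b, b') ∈ H) {κ : ℝ} (hκ : Fintype.card H * κ = 1) (m : ℕ)
    {u : ℕ} (hu : 0 < u) :
    ∃ z : H → ℝ, (∀ s, |z s| ≤ 1) ∧ ∑ s, z s = 0 ∧
      ∑ n ∈ Finset.Ico (u * g ^ m) ((u + 1) * g ^ m),
        deviation (missingDigits g D)
          (fun n => (n : ZMod a) = b ∧ (digitSum g n : ZMod a') = b') κ n =
          ∑ s, wordCount g D H m s * z s := by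
  classical
  obtain ⟨y, rfl, hmin⟩ := exists_minimal_word hg u
  have hcard : (1 : ℝ) ≤ Fintype.card H := by
    exact_mod_cast Fintype.card_pos_iff.2 ⟨(0 : H)⟩
  have hκ0 : 0 ≤ κ := by
    by_contra! h
    nlinarith
  have hκ1 : κ ≤ 1 := by nlinarith
  set z : H → ℝ := fun s => (if IsWordIn D y then 1 else 0) *
    ((if (s : ZMod a × ZMod a') + increment a a' m y = (b, b') then 1 else 0) - κ) with hz
  refine ⟨z, fun s => ?_, ?_, ?_⟩
  · simp only [hz]
    rw [abs_le]
    split_ifs <;> constructor <;> linarith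
  · simp only [hz]
    by_cases hy : IsWordIn D y
    · have h : ∀ s : H, (s : ZMod a × ZMod a') + increment a a' m y = (b, b') ↔
          s = ⟨(b, b') - increment a a' m y, H.sub_mem hb (hinc y hy m)⟩ := fun s => by
        rw [Subtype.ext_iff, eq_sub_iff_add_eq]
      simp only [hy, if_true, one_mul, Finset.sum_sub_distrib, h, Finset.sum_ite_eq',
        Finset.mem_univ, Finset.sum_const, Finset.card_univ, nsmul_eq_mul, hκ, sub_self]
    · simp only [hy, if_false, zero_mul, Finset.sum_const_zero]
  · rw [sum_block_eq_sum_words (by omega)]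
    simp_rw [wordCount, Finset.sum_mul]
    rw [Finset.sum_comm]
    refine Finset.sum_congr rfl fun x hx => ?_
    rw [mem_words] at hx
    subst hx
    have hmem := val_add_mem_missingDigits_iff hg hD hu (x := x) rfl hmin
    by_cases hx : IsWordIn D x
    · rw [Finset.sum_eq_single ⟨_, hinc x hx 0⟩]
      · have h := residues_val_add (a := a) (a' := a') hg x y
        simp only [deviation, hz, hmem, hx, true_and, if_true, one_mul, ← h, Prod.mk.injEq]
        split_ifs <;> simp
      · intro t _ ht
        rw [if_neg fun h => ht (Subtype.ext h.2.symm), zero_mul]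
      · simp
    · rw [Finset.sum_eq_zero fun s _ => by rw [if_neg fun h => hx h.1, zero_mul], deviation,
        if_neg]
      rw [hmem]
      exact fun h => hx h.1

end

/-- Equidistribution of residues and digit sums along integers with missing digits. -/
theorem exists_isBigO_missingDigits (hg : 2 ≤ g) (D : Finset ℕ) (hD0 : D.Nonempty)
    (hD : ∀ d ∈ D, d < g) {a a' : ℕ} (ha : 1 ≤ a) (ha' : 1 ≤ a') (hga : Nat.Coprime g a)
    (haa' : Nat.Coprime a a') {δ δ₁ δ₂ : ℕ} (hδ : δ = digitGcd D hD0 (a * a'))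
    (hδ₁ : δ₁ = Nat.gcd δ a) (hδ₂ : δ₂ = Nat.gcd δ a') (h₁ : δ₁ ∣ D.min' hD0)
    (h₂ : δ₂ ∣ D.min' hD0) :
    ∃ γ : ℝ, 0 < γ ∧ ∀ (b : ZMod a) (b' : ZMod a'),
      ((b ∈ AddSubgroup.zmultiples (δ₁ : ZMod a) ∧ b' ∈ AddSubgroup.zmultiples (δ₂ : ZMod a')) →
        (fun N : ℕ =>
          (count {n | n ∈ missingDigits g D ∧ (n : ZMod a) = b ∧
            (digitSum g n : ZMod a') = b'} N : ℝ) /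
            count (missingDigits g D) N - (δ : ℝ) / ((a : ℝ) * a'))
          =O[atTop] fun N : ℕ => (N : ℝ) ^ (-γ)) ∧
      (¬ (b ∈ AddSubgroup.zmultiples (δ₁ : ZMod a) ∧ b' ∈ AddSubgroup.zmultiples (δ₂ : ZMod a')) →
        {n | n ∈ missingDigits g D ∧ (n : ZMod a) = b ∧ (digitSum g n : ZMod a') = b'} = ∅) := by
  classical
  have : NeZero a := ⟨by omega⟩
  have : NeZero a' := ⟨by omega⟩
  set d₁ := D.min' hD0 with hd₁
  have hd₁D : d₁ ∈ D := D.min'_mem hD0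
  have hmin : ∀ d ∈ D, d₁ ≤ d := fun d hd => D.min'_le d hd
  have hδdvd : ∀ d ∈ D, δ ∣ d - d₁ := fun d hd => by
    rw [hδ]
    exact (Nat.gcd_dvd_right _ _).trans (Finset.gcd_dvd hd)
  have hdvd : ∀ e, e ∣ δ → e ∣ d₁ → ∀ d ∈ D, e ∣ d := fun e he he₁ d hd => by
    have := dvd_add (he.trans (hδdvd d hd)) he₁
    rwa [Nat.sub_add_cancel (hmin d hd)] at this
  set H : AddSubgroup (ZMod a × ZMod a') := (AddSubgroup.zmultiples (δ₁ : ZMod a)).prod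
    (AddSubgroup.zmultiples (δ₂ : ZMod a')) with hH
  let _ : Fintype H := Fintype.ofFinite _
  have hinc : ∀ w : List (Fin g), IsWordIn D w → ∀ m, increment a a' m w ∈ H := fun w hw m =>
    hw.increment_mem (hdvd δ₁ (hδ₁ ▸ Nat.gcd_dvd_left _ _) h₁)
      (hdvd δ₂ (hδ₂ ▸ Nat.gcd_dvd_left _ _) h₂) m
  have hres : ∀ n ∈ missingDigits g D, ((n : ZMod a), (digitSum g n : ZMod a')) ∈ H := by
    intro n hn
    obtain ⟨w, -, hw, rfl⟩ := (mem_missingDigits_iff hD).1 hn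
    have := hinc w hw 0
    rwa [increment, pow_zero, one_mul, ← digitSum_val hg] at this
  have hempty : ∀ (b : ZMod a) (b' : ZMod a'),
      ¬ (b ∈ AddSubgroup.zmultiples (δ₁ : ZMod a) ∧ b' ∈ AddSubgroup.zmultiples (δ₂ : ZMod a')) →
      {n | n ∈ missingDigits g D ∧ (n : ZMod a) = b ∧ (digitSum g n : ZMod a') = b'} = ∅ := by
    intro b b' hb
    refine Set.eq_empty_of_forall_notMem ?_
    rintro n ⟨hn, rfl, rfl⟩
    exact hb (hres n hn)
  have hcard : Nat.card H * δ = a * a' := by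
    rw [hH, hδ₁, hδ₂]
    exact card_prod_zmultiples ha ha' haa' (hδ ▸ Nat.gcd_dvd_left _ _)
  have ha0 : (0 : ℝ) < a := by exact_mod_cast ha
  have ha'0 : (0 : ℝ) < a' := by exact_mod_cast ha'
  have hκ : (Fintype.card H : ℝ) * ((δ : ℝ) / ((a : ℝ) * a')) = 1 := by
    rw [← Nat.card_eq_fintype_card, ← mul_div_assoc, div_eq_one_iff_eq (by positivity)]
    exact_mod_cast hcard
  -- The recurrence argument needs growth rate at least two. With a single digit the only difference
  -- is zero, so `δ = a * a'`, `H` is trivial and the proportion is exactly one once `N ≥ g`.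
  rcases Nat.lt_or_ge D.card 2 with ht | ht
  · have hD1 : D.card = 1 := by have := hD0.card_pos; omega
    obtain ⟨d, rfl⟩ := Finset.card_eq_one.1 hD1
    have hδ' : δ = a * a' := by
      rw [hδ, digitGcd]
      simp
    have hH1 : Nat.card H = 1 := by
      have : 0 < a * a' := Nat.mul_pos ha ha'
      rw [hδ'] at hcard
      exact Nat.eq_of_mul_eq_mul_right this (by rw [hcard, one_mul])
    have hsub : Subsingleton H := (Nat.card_eq_one_iff_unique.1 hH1).1
    refine ⟨1, one_pos, fun b b' => ⟨fun hb => ?_, hempty b b'⟩⟩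
    have hall : {n | n ∈ missingDigits g {d} ∧ (n : ZMod a) = b ∧ (digitSum g n : ZMod a') = b'} =
        missingDigits g {d} := by
      refine Set.Subset.antisymm (fun n hn => hn.1) fun n hn => ⟨hn, ?_⟩
      have := Subtype.ext_iff.1 (hsub.elim ⟨_, hres n hn⟩ ⟨(b, b'), hb⟩)
      exact Prod.mk.inj this
    refine IsBigO.of_bound 0 ?_
    filter_upwards [eventually_ge_atTop (g ^ 1)] with N hN
    have hpos : (0 : ℝ) < count (missingDigits g {d}) N := by
      have h3 := pow_card_le_count_missingDigits hD le_rfl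
      rw [hD1] at h3
      have h4 : (count (missingDigits g {d}) (g ^ 1) : ℝ) ≤ count (missingDigits g {d}) N := by
        exact_mod_cast count_mono _ hN
      norm_num at h3 h4 ⊢
      omega
    rw [hall, div_self hpos.ne', hδ']
    push_cast
    rw [div_self (by positivity), sub_self, norm_zero, zero_mul]
  · obtain ⟨L, hL, hL'⟩ := exists_length_forall_increment_eq (a' := a') hga hD hd₁D hmin
      (fun w hw => hinc w hw 0) (by
        rw [hH, hδ₁, hδ₂]
        exact prod_zmultiples_le_closure haa' hδ)
    have hk0 : (0 : ℝ) < (D.card : ℝ) ^ L := pow_pos (by exact_mod_cast hD0.card_pos) _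
    obtain ⟨γ, hγ, h⟩ := exists_isBigO_of_recurrence hg ht (wordCount g D H) hL (ℓ := 1)
      (inv_pos.2 hk0) (stepProbability g D H L)
      -- One admissible word from `s` to `s'` suffices: it alone has probability `1 / |D| ^ L`, the
      -- chosen `ε`.
      (fun m _ s s' => by
        obtain ⟨w, hw1, hw2, hw3⟩ := exists_increment_eq_of_coprime hga hL' m _
          (H.sub_mem s'.2 s.2)
        unfold stepProbability
        refine le_mul_of_one_le_right (inv_pos.2 hk0).le ?_
        refine le_of_eq_of_le ?_ (Finset.single_le_sum (fun w _ => ?_) (mem_words.2 hw1))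
        · rw [if_pos ⟨hw2, hw3⟩]
        · positivity)
      (fun m _ s' => sum_stepProbability hD hD0 hinc L m s')
      (fun m _ s' => wordCount_add hD0 hinc m L s')
      (missingDigits g D) (c := 1) one_pos
      (fun m hm => by rw [one_mul]; exact pow_card_le_count_missingDigits hD hm)
    exact ⟨γ, hγ, fun b b' => ⟨fun hb => h _ _ fun m _ u hu =>
      exists_sum_deviation_missingDigits hg hD hinc hb hκ m hu, hempty b b'⟩⟩

end DigitShift

theorem mainTheorem10 :
    -- the general statement for mixing, sofic, regular shifts
    (∀ (g : ℕ), 2 ≤ g → ∀ (r : ℕ) (a : Fin r → ℕ) [∀ j, NeZero (a j)] (f : Fin r → ℕ → ℤ),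
      (∀ j, DigitShift.IsGAdditive g (f j)) →
      ∀ (S : DigitShift.Shift g) (hS : DigitShift.IsSofic S), DigitShift.IsMixing S →
      ∀ k : ℕ, 2 ≤ k → (DigitShift.fischerCover S).IsRegular k →
      ∀ p ℓ : ℕ, DigitShift.IsEventualPeriod g a f p ℓ →
      (∃ w, DigitShift.IsSynchronizing S w ∧ w.length ≤ ℓ) →
      DigitShift.MarkovCondition S hS a f k p ℓ →
      ∃ γ : ℝ, 0 < γ ∧ ∀ b : (∀ j, ZMod (a j)),
        (fun N : ℕ =>
          (DigitShift.count {n | n ∈ DigitShift.restrictedIntegers S ℓ ∧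
              DigitShift.Congr a f n b} N : ℝ) /
            DigitShift.count (DigitShift.restrictedIntegers S ℓ) N - 1 / ∏ j, (a j : ℝ))
          =O[atTop] fun N : ℕ => (N : ℝ) ^ (-γ)) ∧
    -- the rate for missing digits sets
    (∀ (g : ℕ), 2 ≤ g → ∀ (D : Finset ℕ) (hD : D.Nonempty), (∀ d ∈ D, d < g) →
      ∀ a a' : ℕ, 1 ≤ a → 1 ≤ a' → Nat.Coprime g a → Nat.Coprime a a' →
      ∀ δ δ₁ δ₂ : ℕ, δ = DigitShift.digitGcd D hD (a * a') →
      δ₁ = Nat.gcd δ a → δ₂ = Nat.gcd δ a' →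
      δ₁ ∣ D.min' hD → δ₂ ∣ D.min' hD →
      ∃ γ : ℝ, 0 < γ ∧ ∀ (b : ZMod a) (b' : ZMod a'),
        ((b ∈ AddSubgroup.zmultiples (δ₁ : ZMod a) ∧
            b' ∈ AddSubgroup.zmultiples (δ₂ : ZMod a')) →
          (fun N : ℕ =>
            (DigitShift.count {n | n ∈ DigitShift.missingDigits g D ∧ (n : ZMod a) = b ∧
                (DigitShift.digitSum g n : ZMod a') = b'} N : ℝ) /
              DigitShift.count (DigitShift.missingDigits g D) N - (δ : ℝ) / ((a : ℝ) * a'))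
            =O[atTop] fun N : ℕ => (N : ℝ) ^ (-γ)) ∧
        (¬ (b ∈ AddSubgroup.zmultiples (δ₁ : ZMod a) ∧
            b' ∈ AddSubgroup.zmultiples (δ₂ : ZMod a')) →
          {n | n ∈ DigitShift.missingDigits g D ∧ (n : ZMod a) = b ∧
            (DigitShift.digitSum g n : ZMod a') = b'} = ∅)) := by
  refine ⟨?_, ?_⟩
  · intro g hg r a _ f hf S hS _ k hk hreg p ℓ hp hsync hM
    exact DigitShift.exists_isBigO_restrictedIntegers hg a f hf S hS hk hreg hp hsync hM
  · intro g hg D hD hDg a a' ha ha' hga haa' δ δ₁ δ₂ hδ hδ₁ hδ₂ h₁ h₂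
    exact DigitShift.exists_isBigO_missingDigits hg D hD hDg ha ha' hga haa' hδ hδ₁ hδ₂ h₁ h₂
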